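/- For a positive integer $N$ write $[N]=\{1,\dots,N\}$ and regard $[N]\times[N]$ as a set of points in the Euclidean plane. A triangle means a non-degenerate triangle (three non-collinear vertices), identified with its set of vertices, and its perimeter is the sum of its three Euclidean side lengths. For real $p>0$ let $T_N(p)$ be the number of triangles of perimeter $p$ with all three vertices in $[N]\times[N]$. Then there are absolute constants $C_1,c_1,c_2,C_3,c_3,c_4>0$ such that the following hold. (a) For every integer $n\ge 3$, the maximum number of triangles of equal perimeter in the grid $[\lfloor\sqrt n\rfloor]\times[\lfloor\sqrt n\rfloor]$ satisfies $$\max_{p>0}T_{\lfloor\sqrt n\rfloor}(p)\le C_1\,n^{3/2+c_1/\log\log n},$$ that is, it is $O\bigl(n^{3/2+O(1/\log\log n)}\bigr)$. For every integer $n\ge 4$, $$\max_{p>0}T_{\lfloor\sqrt n\rfloor}(p)\ge c_2\,n^{5/4},$$ that is, it is $\Omega(n^{5/4})$. (b) For every integer $n\ge 3$ and every real $p>0$, $$T_n(p)\le C_3\,n^{3+c_3/\log\log n}.$$ For every integer $n\ge 2$ there is a real $p>0$ with $$T_n(p)\ge c_4\,n^{5/2}.$$ -/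

import Mathlib

namespace GridTriangles

/-- The Euclidean plane. -/
abbrev Plane := EuclideanSpace ℝ (Fin 2)

/-- The grid `[N] × [N]`, where `[N] = {1, …, N}`, as a set of points of the Euclidean plane. -/
def grid (N : ℕ) : Set Plane :=
  {v | ∃ i ∈ Finset.Icc 1 N, ∃ j ∈ Finset.Icc 1 N, v = !₂[(i : ℝ), (j : ℝ)]}

/-- `T` is the vertex set of a non-degenerate triangle of perimeter `p`. -/
def IsTriangleOfPerimeter (T : Set Plane) (p : ℝ) : Prop :=
  ∃ A B C : Plane, T = {A, B, C} ∧ AffineIndependent ℝ ![A, B, C] ∧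
    dist A B + dist B C + dist C A = p

/-- The (non-degenerate) triangles of perimeter `p` with all vertices in `[N] × [N]`. A triangle
is identified with its set of vertices, so that each triangle is counted once. -/
def trianglesOfPerimeter (N : ℕ) (p : ℝ) : Set (Set Plane) :=
  {T | T ⊆ grid N ∧ IsTriangleOfPerimeter T p}

/-- The number of triangles of perimeter `p` with all vertices in `[N] × [N]`. -/
noncomputable def triangleCount (N : ℕ) (p : ℝ) : ℕ :=
  (trianglesOfPerimeter N p).ncard

/-- The maximum number of triangles of equal perimeter with all vertices in `[N] × [N]`.
It is a true maximum: see `isGreatest_maxTriangleCount`. -/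
noncomputable def maxTriangleCount (N : ℕ) : ℕ :=
  sSup (Set.range fun p : ℝ => triangleCount N p)

theorem grid_finite (N : ℕ) : (grid N).Finite := by
  refine ((Finset.Icc 1 N ×ˢ Finset.Icc 1 N).finite_toSet.image
    fun q : ℕ × ℕ => (!₂[(q.1 : ℝ), (q.2 : ℝ)] : Plane)).subset ?_
  rintro v ⟨i, hi, j, hj, rfl⟩
  exact ⟨(i, j), Finset.mem_coe.2 (Finset.mem_product.2 ⟨hi, hj⟩), rfl⟩

theorem trianglesOfPerimeter_finite (N : ℕ) (p : ℝ) : (trianglesOfPerimeter N p).Finite :=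
  (grid_finite N).finite_subsets.subset fun _ hT => hT.1

theorem isGreatest_maxTriangleCount (N : ℕ) :
    IsGreatest (Set.range fun p : ℝ => triangleCount N p) (maxTriangleCount N) := by
  have hb : BddAbove (Set.range fun p : ℝ => triangleCount N p) := by
    refine ⟨{T : Set Plane | T ⊆ grid N}.ncard, ?_⟩
    rintro _ ⟨p, rfl⟩
    exact Set.ncard_le_ncard (fun _ hT => hT.1) (grid_finite N).finite_subsets
  exact ⟨Nat.sSup_mem (Set.range_nonempty _) hb, fun _ hx => le_csSup hb hx⟩

end GridTriangles

namespace GridTriangles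
open Finset

/-! Upper bound. Squared side lengths of lattice triangles are integers, so a perimeter is a sum of
three square roots. Square roots from different square classes (integers modulo rational squares)
are independent over `ℚ`, so the perimeter fixes the contribution of each class
(`sum_sqrt_squareClass`). If some side is alone in its class, one further side determines the
triple, and that side has `O(N)` possible values (`card_triples_alone_le`). Otherwise the sides are
`x√d, y√d, z√d` with `x + y + z = s` fixed. By Heron's formula `s(s-2x)(s-2y)(s-2z)` is a perfect
square. For fixed `x`, the numbers `s-2y` and `s-2z` have a known sum and a product in a known
class, which reduces to primitive representations by a form `f₁u² + f₂v²` and costs only divisor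
functions (`card_isSquare_mul_le`). Hence a perimeter admits `N` times a power of the divisor bound
many side triples. Given the first vertex (`N²` choices) and the sides, the other two vertices are
lattice points on circles, again few (`card_sq_add_sq_le`). The total is `N³` times a fixed power of
the divisor bound `X^(O(1/log log X))`.

Lower bound. For Gaussian integers `μ, ρ` the points `A`, `A + (2μρ)²`, `A + (μ² + ρ²)²` form a
triangle with sides `4|μ|²|ρ|²`, `|μ² - ρ²|²`, `|μ² + ρ²|²`, and perimeter `2(|μ|² + |ρ|²)²` by the
parallelogram law (`perimeter_family`). With `μ, ρ` of size `R ≈ N^(1/4)` there are about `N² R⁴`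
such triangles but only `O(R²)` perimeters, so some perimeter occurs `≫ N² R² ≈ N^(5/2)` times
(`exists_triangleCount_ge`). -/

/-! ### The divisor bound -/

theorem succ_le_mul_two_rpow {ε : ℝ} (hε : 0 < ε) (e : ℕ) :
    (e : ℝ) + 1 ≤ (1 + 2 / ε) * (2 : ℝ) ^ (ε * e) := by
  have h1 : 1 + ε * e / 2 ≤ (2 : ℝ) ^ (ε * e) := by
    rw [Real.rpow_def_of_pos two_pos]
    have h2 := Real.add_one_le_exp (Real.log 2 * (ε * e))
    have h3 : (1 / 2 : ℝ) ≤ Real.log 2 := by linarith [Real.log_two_gt_d9]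
    have h4 : 0 ≤ ε * e := by positivity
    nlinarith
  have h5 : (1 + 2 / ε) * (1 + ε * e / 2) = 1 + e + 2 / ε + ε * e / 2 := by
    field_simp
    ring
  have h6 : 0 < 2 / ε := by positivity
  have h7 : 0 ≤ ε * e / 2 := by positivity
  nlinarith [mul_le_mul_of_nonneg_left h1 (by positivity : 0 ≤ 1 + 2 / ε)]

/-- In the product of `e + 1` over prime powers `q^e`, a prime `q ≥ 2^(1/ε)` satisfies `e + 1 ≤ 2^e
≤ q^(εe)`. Each smaller prime loses at most a factor `1 + 2/ε`, and there are at most `2^(1/ε)` of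
them. -/
theorem card_divisors_le_rpow {ε : ℝ} (hε : 0 < ε) {m : ℕ} (hm : m ≠ 0) :
    (#m.divisors : ℝ) ≤ (m : ℝ) ^ ε * (1 + 2 / ε) ^ ((2 : ℝ) ^ (1 / ε)) := by
  set t : ℝ := (2 : ℝ) ^ (1 / ε) with ht
  have ht0 : 0 < t := by positivity
  have hC : 1 ≤ 1 + 2 / ε := by
    have : 0 < 2 / ε := by positivity
    linarith
  have hmε : (m : ℝ) ^ ε = ∏ q ∈ m.primeFactors, ((q : ℝ) ^ (ε * m.factorization q)) := by
    conv_lhs => rw [← Nat.prod_factorization_pow_eq_self hm]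
    rw [Finsupp.prod, Nat.support_factorization, Nat.cast_prod,
      ← Real.finsetProd_rpow _ _ (fun _ _ => by positivity)]
    refine Finset.prod_congr rfl fun q _ => ?_
    rw [Nat.cast_pow, ← Real.rpow_natCast, ← Real.rpow_mul (by positivity), mul_comm]
  have hstep : ∀ q ∈ m.primeFactors, ((m.factorization q : ℝ) + 1) ≤
      (if (q : ℝ) < t then 1 + 2 / ε else 1) * (q : ℝ) ^ (ε * m.factorization q) := by
    intro q hq
    have hq2 : (2 : ℝ) ≤ q := by exact_mod_cast (Nat.prime_of_mem_primeFactors hq).two_le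
    split_ifs with h
    · refine (succ_le_mul_two_rpow hε _).trans ?_
      gcongr
    · rw [one_mul]
      push Not at h
      have h1 : (2 : ℝ) ≤ (q : ℝ) ^ ε := by
        calc (2 : ℝ) = t ^ ε := by
              rw [ht, ← Real.rpow_mul two_pos.le, one_div_mul_cancel hε.ne', Real.rpow_one]
          _ ≤ _ := by gcongr
      rw [Real.rpow_mul (by positivity), Real.rpow_natCast]
      calc ((m.factorization q : ℝ) + 1) ≤ 2 ^ (m.factorization q) := by
            exact_mod_cast Nat.lt_two_pow_self
        _ ≤ _ := by gcongr
  have hcard : (#(m.primeFactors.filter fun q : ℕ => (q : ℝ) < t) : ℝ) ≤ t := by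
    have hsub : (m.primeFactors.filter fun q : ℕ => (q : ℝ) < t) ⊆ Finset.Icc 1 ⌊t⌋₊ := by
      intro q hq
      rw [Finset.mem_filter] at hq
      exact Finset.mem_Icc.2 ⟨(Nat.prime_of_mem_primeFactors hq.1).one_le, Nat.le_floor hq.2.le⟩
    have := Finset.card_le_card hsub
    rw [Nat.card_Icc, Nat.add_sub_cancel] at this
    exact (Nat.cast_le.2 this).trans (Nat.floor_le ht0.le)
  calc (#m.divisors : ℝ) = ∏ q ∈ m.primeFactors, ((m.factorization q : ℝ) + 1) := by
        rw [Nat.card_divisors hm]; push_cast; rfl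
    _ ≤ ∏ q ∈ m.primeFactors,
        ((if (q : ℝ) < t then 1 + 2 / ε else 1) * (q : ℝ) ^ (ε * m.factorization q)) :=
        Finset.prod_le_prod (fun _ _ => by positivity) hstep
    _ = (1 + 2 / ε) ^ (#(m.primeFactors.filter fun q : ℕ => (q : ℝ) < t)) * (m : ℝ) ^ ε := by
        rw [Finset.prod_mul_distrib, ← hmε, Finset.prod_ite]
        simp
    _ ≤ (1 + 2 / ε) ^ t * (m : ℝ) ^ ε := by
        gcongr
        rw [← Real.rpow_natCast]
        exact Real.rpow_le_rpow_of_exponent_le hC hcard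
    _ = _ := mul_comm _ _

/-- The divisor bound `d(m) ≤ X ^ O(1 / log log X)` for all `m` polynomially bounded in `X`. -/
theorem exists_card_divisors_le : ∃ c : ℝ, 0 < c ∧ ∀ X : ℕ, 3 ≤ X → ∀ m : ℕ, m ≠ 0 → m ≤ X ^ 6 →
    (#m.divisors : ℝ) ≤ (X : ℝ) ^ (c / Real.log (Real.log X)) := by
  have hl2 : (1 / 2 : ℝ) ≤ Real.log 2 := by linarith [Real.log_two_gt_d9]
  refine ⟨12 * Real.log 2 + 32, by positivity, fun X hX m hm hmX => ?_⟩
  have hX3 : (3 : ℝ) ≤ X := by exact_mod_cast hX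
  have hX0 : (0 : ℝ) < X := by linarith
  set L := Real.log X with hL
  have hL1 : 1 < L := by
    rw [hL, Real.lt_log_iff_exp_lt hX0]
    linarith [Real.exp_one_lt_d9]
  have hL0 : 0 < L := by linarith
  set l := Real.log L with hl
  have hl0 : 0 < l := Real.log_pos hL1
  -- This choice makes `2^(1/ε) = √L`, so the small primes contribute `exp(2l√L)`, which is below
  -- `exp(32L/l)`.
  set ε := 2 * Real.log 2 / l with hε
  have hε0 : 0 < ε := by positivity
  have h1 := card_divisors_le_rpow hε0 hm
  have h2 : (2 : ℝ) ^ (1 / ε) = L ^ (1 / 2 : ℝ) := by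
    rw [Real.rpow_def_of_pos two_pos, Real.rpow_def_of_pos hL0, ← hl, hε]
    congr 1
    field_simp
  have h3 : (1 + 2 / ε) ≤ Real.exp (2 * l) := by
    have : 2 / ε ≤ 2 * l := by
      rw [hε, div_div_eq_mul_div, div_le_iff₀ (by positivity)]
      nlinarith
    linarith [Real.add_one_le_exp (2 * l)]
  have h4 : l ≤ 4 * L ^ (1 / 4 : ℝ) := by
    have := Real.log_le_rpow_div hL0.le (by norm_num : (0 : ℝ) < 1 / 4)
    rw [hl]; linarith
  have h5 : l ^ 2 * L ^ (1 / 2 : ℝ) ≤ 16 * L := by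
    have h6 : (L ^ (1 / 4 : ℝ)) ^ 2 = L ^ (1 / 2 : ℝ) := by
      rw [← Real.rpow_natCast, ← Real.rpow_mul hL0.le]; norm_num
    have h7 : L ^ (1 / 2 : ℝ) * L ^ (1 / 2 : ℝ) = L := by
      rw [← Real.rpow_add hL0]; norm_num
    have h8 : l ^ 2 ≤ 16 * L ^ (1 / 2 : ℝ) := by
      rw [← h6]; nlinarith
    have h9 : 0 < L ^ (1 / 2 : ℝ) := by positivity
    nlinarith
  have h6 : (m : ℝ) ^ ε ≤ Real.exp (L * (12 * Real.log 2 / l)) := by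
    have : (m : ℝ) ≤ (X : ℝ) ^ 6 := by exact_mod_cast hmX
    calc (m : ℝ) ^ ε ≤ ((X : ℝ) ^ 6) ^ ε := by gcongr
      _ = _ := by
        rw [← Real.rpow_natCast, ← Real.rpow_mul hX0.le, Real.rpow_def_of_pos hX0, ← hL, hε]
        congr 1; push_cast; ring
  have h7 : (1 + 2 / ε) ^ ((2 : ℝ) ^ (1 / ε)) ≤ Real.exp (L * (32 / l)) := by
    calc (1 + 2 / ε) ^ ((2 : ℝ) ^ (1 / ε)) ≤ (Real.exp (2 * l)) ^ ((2 : ℝ) ^ (1 / ε)) := by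
          gcongr
      _ = Real.exp (2 * l * L ^ (1 / 2 : ℝ)) := by rw [← Real.exp_mul, h2]
      _ ≤ _ := by
          rw [Real.exp_le_exp, mul_div_assoc', le_div_iff₀ hl0]
          linarith
  calc (#m.divisors : ℝ) ≤ _ := h1
    _ ≤ Real.exp (L * (12 * Real.log 2 / l)) * Real.exp (L * (32 / l)) := by gcongr
    _ = _ := by
      rw [← Real.exp_add, Real.rpow_def_of_pos hX0, ← hL]
      congr 1; ring

/-! ### Representations by diagonal binary quadratic forms -/

/-- Brahmagupta's identity gives `E² + f₁f₂D² = M²` with `D = u₁v - uv₁` and `E = f₁u₁u + f₂v₁v`. So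
`|D| ≤ M`, and `2D/M` is one of five integers. Together with the sign of `E` it fixes `D` and `E`,
hence `(u, v)`. -/
theorem card_form_fiber_le {f₁ f₂ M u₁ v₁ : ℤ} (hf₁ : 0 < f₁) (hf₂ : 0 < f₂) (hM : 0 < M)
    (h₁ : f₁ * u₁ ^ 2 + f₂ * v₁ ^ 2 = M) (S : Finset (ℤ × ℤ))
    (hS : ∀ q ∈ S, f₁ * q.1 ^ 2 + f₂ * q.2 ^ 2 = M ∧ M ∣ 2 * (u₁ * q.2 - q.1 * v₁)) :
    #S ≤ 10 := by
  have hkey : ∀ q ∈ S, (f₁ * u₁ * q.1 + f₂ * v₁ * q.2) ^ 2 +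
      f₁ * f₂ * (u₁ * q.2 - q.1 * v₁) ^ 2 = M ^ 2 := by
    intro q hq
    rw [show M ^ 2 = M * M by ring]
    nth_rw 1 [← h₁]
    rw [← (hS q hq).1]; ring
  have hcard : #(Finset.Icc (-2 : ℤ) 2 ×ˢ (Finset.univ : Finset Bool)) = 10 := by decide
  rw [← hcard]
  refine Finset.card_le_card_of_injOn
    (fun q => (2 * (u₁ * q.2 - q.1 * v₁) / M, decide (0 ≤ f₁ * u₁ * q.1 + f₂ * v₁ * q.2))) ?_ ?_
  · intro q hq
    obtain ⟨k, hk⟩ := (hS q hq).2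
    have h := hkey q hq
    have hD : (u₁ * q.2 - q.1 * v₁) ^ 2 ≤ M ^ 2 := by
      have : 1 ≤ f₁ * f₂ := by nlinarith
      nlinarith [sq_nonneg (f₁ * u₁ * q.1 + f₂ * v₁ * q.2), sq_nonneg (u₁ * q.2 - q.1 * v₁)]
    have hD' := abs_le_of_sq_le_sq' hD hM.le
    simp only [coe_product, Set.mem_prod, mem_coe, mem_Icc, mem_univ, and_true]
    rw [hk, Int.mul_ediv_cancel_left _ hM.ne']
    constructor <;> nlinarith
  · intro q hq q' hq' h
    simp only [Prod.mk.injEq, decide_eq_decide] at h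
    obtain ⟨k, hk⟩ := (hS q hq).2
    obtain ⟨k', hk'⟩ := (hS q' hq').2
    obtain ⟨hD, hE⟩ := h
    rw [hk, hk', Int.mul_ediv_cancel_left _ hM.ne', Int.mul_ediv_cancel_left _ hM.ne'] at hD
    have hDD : u₁ * q.2 - q.1 * v₁ = u₁ * q'.2 - q'.1 * v₁ := by
      rw [hD] at hk; linarith
    have hEE : f₁ * u₁ * q.1 + f₂ * v₁ * q.2 = f₁ * u₁ * q'.1 + f₂ * v₁ * q'.2 := by
      have h := hkey q hq
      have h' := hkey q' hq'
      rw [hDD] at h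
      have h2 : (f₁ * u₁ * q.1 + f₂ * v₁ * q.2) ^ 2 = (f₁ * u₁ * q'.1 + f₂ * v₁ * q'.2) ^ 2 := by
        linarith
      by_cases hc : 0 ≤ f₁ * u₁ * q.1 + f₂ * v₁ * q.2
      · exact (sq_eq_sq₀ hc (hE.1 hc)).1 h2
      · have hc' := fun x => hc (hE.2 x)
        rw [not_le] at hc
        replace hc' := lt_of_not_ge hc'
        rcases sq_eq_sq_iff_eq_or_eq_neg.1 h2 with h3 | h3
        · exact h3
        · linarith
    have e1 : M * q.1 = M * q'.1 := by
      rw [← h₁]; linear_combination u₁ * hEE - f₂ * v₁ * hDD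
    have e2 : M * q.2 = M * q'.2 := by
      rw [← h₁]; linear_combination v₁ * hEE + f₁ * u₁ * hDD
    exact Prod.ext (mul_left_cancel₀ hM.ne' e1) (mul_left_cancel₀ hM.ne' e2)

/-- The number of primitive representations of `M` by the form `f₁ u² + f₂ v²`. -/
theorem card_primitive_form_le {f₁ f₂ M : ℤ} (hf₁ : 0 < f₁) (hf₂ : 0 < f₂) (S : Finset (ℤ × ℤ))
    (hS : ∀ q ∈ S, f₁ * q.1 ^ 2 + f₂ * q.2 ^ 2 = M ∧ IsCoprime (f₁ * q.1) (f₂ * q.2)) :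
    #S ≤ 10 * #M.natAbs.divisors := by
  rcases S.eq_empty_or_nonempty with rfl | ⟨⟨u₀, v₀⟩, h₀⟩
  · simp
  have hM : 0 < M := by
    obtain ⟨h1, h2⟩ := hS _ h₀
    rcases (by rw [← h1]; positivity : 0 ≤ M).lt_or_eq with h | h
    · exact h
    · exfalso
      simp only at h1 h2
      have hu : u₀ = 0 := by
        by_contra hu
        have : 0 < u₀ ^ 2 := by positivity
        nlinarith [mul_pos hf₁ this, mul_nonneg hf₂.le (sq_nonneg v₀)]
      have hv : v₀ = 0 := by
        by_contra hv
        have : 0 < v₀ ^ 2 := by positivity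
        nlinarith [mul_pos hf₂ this, mul_nonneg hf₁.le (sq_nonneg u₀)]
      subst hu hv
      simp only [isCoprime_zero_left, mul_zero] at h2
      exact not_isUnit_zero h2
  have hcop : ∀ q ∈ S, IsCoprime M q.1 ∧ IsCoprime M q.2 ∧ IsCoprime M f₁ := by
    intro q hq
    obtain ⟨h1, h2⟩ := hS q hq
    have ha : IsCoprime (f₁ * q.1) M := by
      rw [← h1, show f₁ * q.1 ^ 2 + f₂ * q.2 ^ 2 = f₂ * q.2 * q.2 + q.1 * (f₁ * q.1) by ring]
      exact IsCoprime.add_mul_right_right (h2.mul_right (h2.of_mul_right_right)) _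
    have hb : IsCoprime (f₂ * q.2) M := by
      rw [← h1, show f₁ * q.1 ^ 2 + f₂ * q.2 ^ 2 = f₁ * q.1 * q.1 + q.2 * (f₂ * q.2) by ring]
      exact IsCoprime.add_mul_right_right (h2.symm.mul_right (h2.symm.of_mul_right_right)) _
    exact ⟨ha.of_mul_left_right.symm, hb.of_mul_left_right.symm, ha.of_mul_left_left.symm⟩
  -- Relative to a fixed solution `(u₀, v₀)`, the product `(uv₀ - u₀v)(uv₀ + u₀v)` is divisible by
  -- `M`. Each solution is classified by the divisor `d` of `M` captured by the first factor. Two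
  -- solutions with the same `d` satisfy the divisibility required by `card_form_fiber_le`.
  refine Finset.card_le_mul_card_image_of_maps_to
    (f := fun q : ℤ × ℤ => Int.gcd (q.1 * v₀ - u₀ * q.2) M) ?_ 10 ?_
  · intro q _
    rw [Nat.mem_divisors]
    exact ⟨Int.natCast_dvd.1 (Int.gcd_dvd_right ..), by simpa using hM.ne'⟩
  · intro d _
    rcases (S.filter fun q : ℤ × ℤ => Int.gcd (q.1 * v₀ - u₀ * q.2) M = d).eq_empty_or_nonempty
      with he | ⟨⟨u₁, v₁⟩, h₁⟩
    · rw [he]; simp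
    rw [Finset.mem_filter] at h₁
    refine card_form_fiber_le hf₁ hf₂ hM (hS _ h₁.1).1 _ fun q hq => ?_
    rw [Finset.mem_filter] at hq
    refine ⟨(hS q hq.1).1, ?_⟩
    obtain ⟨d', hd'⟩ : (d : ℤ) ∣ M := by rw [← hq.2]; exact Int.gcd_dvd_right ..
    have hd0 : (d : ℤ) ≠ 0 := by rintro h; rw [h] at hd'; simp at hd'; exact hM.ne' hd'
    -- the complementary divisor divides the conjugate expression
    have hconj : ∀ q ∈ S, Int.gcd (q.1 * v₀ - u₀ * q.2) M = d →
        (d : ℤ) ∣ q.1 * v₀ - u₀ * q.2 ∧ d' ∣ q.1 * v₀ + u₀ * q.2 := by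
      intro q hq hqd
      refine ⟨by rw [← hqd]; exact Int.gcd_dvd_left .., ?_⟩
      have h1 : M ∣ f₁ * ((q.1 * v₀ - u₀ * q.2) * (q.1 * v₀ + u₀ * q.2)) := by
        refine ⟨v₀ ^ 2 - q.2 ^ 2, ?_⟩
        have e1 := (hS _ hq).1
        have e2 := (hS _ h₀).1
        simp only at e2
        linear_combination v₀ ^ 2 * e1 - q.2 ^ 2 * e2
      have h2 := (hcop q hq).2.2.dvd_of_dvd_mul_left h1
      obtain ⟨w, hw⟩ : (d : ℤ) ∣ q.1 * v₀ - u₀ * q.2 := by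
        rw [← hqd]; exact Int.gcd_dvd_left ..
      have hcop' : IsCoprime d' w := by
        rw [Int.isCoprime_iff_gcd_eq_one]
        have : Int.gcd ((d : ℤ) * w) (d * d') = d := by rw [← hw, ← hd', hqd]
        rw [Int.gcd_mul_left, Int.natAbs_natCast] at this
        rw [Int.gcd_comm]
        have hdn : 0 < d := Nat.pos_of_ne_zero (by exact_mod_cast hd0)
        exact Nat.eq_of_mul_eq_mul_left hdn (by linarith)
      rw [hw, hd', mul_assoc] at h2
      exact hcop'.dvd_of_dvd_mul_left (Int.dvd_of_mul_dvd_mul_left hd0 h2)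
    obtain ⟨a1, a2⟩ := hconj q hq.1 hq.2
    obtain ⟨b1, b2⟩ := hconj _ h₁.1 h₁.2
    simp only at b1 b2
    have hdM : (d : ℤ) ∣ M := ⟨d', hd'⟩
    have hd'M : d' ∣ M := ⟨d, by rw [hd']; ring⟩
    have hv0 := (hcop _ h₀).2.1
    -- Modulo `d` both solutions have ratio `u₀/v₀`, and modulo `d'` both have ratio `-u₀/v₀`; so
    -- their determinant vanishes modulo each.
    have c1 : (d : ℤ) ∣ u₁ * q.2 - q.1 * v₁ := by
      refine (hv0.of_isCoprime_of_dvd_left hdM).dvd_of_dvd_mul_left ?_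
      rw [show v₀ * (u₁ * q.2 - q.1 * v₁) =
        q.2 * (u₁ * v₀ - u₀ * v₁) - v₁ * (q.1 * v₀ - u₀ * q.2) by ring]
      exact dvd_sub (b1.mul_left q.2) (a1.mul_left v₁)
    have c2 : d' ∣ u₁ * q.2 - q.1 * v₁ := by
      refine (hv0.of_isCoprime_of_dvd_left hd'M).dvd_of_dvd_mul_left ?_
      rw [show v₀ * (u₁ * q.2 - q.1 * v₁) =
        q.2 * (u₁ * v₀ + u₀ * v₁) - v₁ * (q.1 * v₀ + u₀ * q.2) by ring]
      exact dvd_sub (b2.mul_left q.2) (a2.mul_left v₁)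
    -- the two divisors have greatest common divisor dividing `2`
    set g : ℤ := ((Int.gcd (d : ℤ) d' : ℕ) : ℤ) with hg
    have g1 : g ∣ d := Int.gcd_dvd_left ..
    have g2 : g ∣ d' := Int.gcd_dvd_right ..
    have hg2 : g ∣ 2 := by
      have h3 : g ∣ 2 * (q.1 * v₀) := by
        rw [show 2 * (q.1 * v₀) = (q.1 * v₀ - u₀ * q.2) + (q.1 * v₀ + u₀ * q.2) by ring]
        exact dvd_add (g1.trans a1) (g2.trans a2)
      have h4 : IsCoprime g (q.1 * v₀) :=
        (((hcop q hq.1).1).mul_right hv0).of_isCoprime_of_dvd_left (g1.trans hdM)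
      exact h4.dvd_of_dvd_mul_right h3
    -- By Bézout, `d` and `d'` both dividing the determinant gives `M = dd'` dividing `g` times it,
    -- and `g` divides `2`.
    obtain ⟨x, y, hxy⟩ : ∃ x y : ℤ, g = d * x + d' * y := ⟨_, _, Int.gcd_eq_gcd_ab _ _⟩
    obtain ⟨z, hz⟩ := hg2
    obtain ⟨s, hs⟩ := c1
    obtain ⟨r, hr⟩ := c2
    refine ⟨z * (x * r + y * s), ?_⟩
    rw [hz, hd']
    calc g * z * (u₁ * q.2 - q.1 * v₁)
        = z * (d * x * (u₁ * q.2 - q.1 * v₁) + d' * y * (u₁ * q.2 - q.1 * v₁)) := by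
          rw [hxy]; ring
      _ = z * (d * x * (d' * r) + d' * y * (d * s)) := by
          nth_rw 1 [hr]; rw [hs]
      _ = _ := by ring

/-- The number of representations of `m` as a sum of two squares. -/
theorem card_sq_add_sq_le {m : ℕ} (hm : m ≠ 0) (S : Finset (ℤ × ℤ))
    (hS : ∀ q ∈ S, q.1 ^ 2 + q.2 ^ 2 = m) : #S ≤ 10 * #m.divisors * #m.divisors := by
  have hg0 : ∀ q ∈ S, Int.gcd q.1 q.2 ≠ 0 := by
    intro q hq h
    rw [Int.gcd_eq_zero_iff] at h
    have := hS q hq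
    rw [h.1, h.2] at this
    apply hm
    exact_mod_cast this.symm
  have hgm : ∀ q ∈ S, ((Int.gcd q.1 q.2 : ℕ) : ℤ) ^ 2 ∣ m := by
    intro q hq
    rw [← hS q hq]
    exact dvd_add (pow_dvd_pow_of_dvd (Int.gcd_dvd_left ..) 2)
      (pow_dvd_pow_of_dvd (Int.gcd_dvd_right ..) 2)
  -- Dividing out the gcd `g` leaves a primitive representation of `m / g²`.
  refine Finset.card_le_mul_card_image_of_maps_to
    (f := fun q : ℤ × ℤ => Int.gcd q.1 q.2) ?_ _ ?_
  · intro q hq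
    rw [Nat.mem_divisors]
    refine ⟨?_, hm⟩
    have := hgm q hq
    exact (dvd_pow_self _ two_ne_zero).trans (by exact_mod_cast this)
  · intro g _
    rcases (S.filter fun q : ℤ × ℤ => Int.gcd q.1 q.2 = g).eq_empty_or_nonempty
      with he | ⟨q₁, h₁⟩
    · rw [he]; simp
    rw [Finset.mem_filter] at h₁
    have hg : (g : ℤ) ≠ 0 := by rw [← h₁.2]; exact_mod_cast hg0 _ h₁.1
    obtain ⟨M, hM⟩ : (g : ℤ) ^ 2 ∣ m := by rw [← h₁.2]; exact hgm _ h₁.1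
    set F := S.filter fun q : ℤ × ℤ => Int.gcd q.1 q.2 = g with hF
    have hdiv : ∀ q ∈ F, (g : ℤ) * (q.1 / g) = q.1 ∧ (g : ℤ) * (q.2 / g) = q.2 := by
      intro q hq
      rw [hF, Finset.mem_filter] at hq
      rw [← hq.2]
      exact ⟨Int.mul_ediv_cancel' (Int.gcd_dvd_left ..),
        Int.mul_ediv_cancel' (Int.gcd_dvd_right ..)⟩
    have hinj : Set.InjOn (fun q : ℤ × ℤ => (q.1 / (g : ℤ), q.2 / (g : ℤ))) F := by
      intro q hq q' hq' h
      simp only [Prod.mk.injEq] at h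
      obtain ⟨a, b⟩ := hdiv q hq
      obtain ⟨a', b'⟩ := hdiv q' hq'
      exact Prod.ext (by rw [← a, ← a', h.1]) (by rw [← b, ← b', h.2])
    rw [← Finset.card_image_of_injOn hinj]
    refine (card_primitive_form_le (f₁ := 1) (f₂ := 1) (M := M) one_pos one_pos _ ?_).trans ?_
    · intro r hr
      obtain ⟨q, hq, rfl⟩ := Finset.mem_image.1 hr
      obtain ⟨a, b⟩ := hdiv q hq
      rw [hF, Finset.mem_filter] at hq
      have hs := hS q hq.1
      rw [← a, ← b, hM] at hs
      refine ⟨mul_left_cancel₀ (pow_ne_zero 2 hg) (by linear_combination hs), ?_⟩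
      rw [one_mul, one_mul, Int.isCoprime_iff_gcd_eq_one, ← hq.2]
      exact Int.gcd_ediv_gcd_ediv_gcd (Nat.pos_of_ne_zero (hg0 q hq.1))
    · gcongr
      · rw [← Int.natCast_dvd_natCast, Int.natCast_natAbs, abs_dvd]
        exact ⟨(g : ℤ) ^ 2, by rw [hM]; ring⟩

/-! ### Square classes and sums with prescribed product class -/

theorem exists_eq_mul_sq {d k : ℕ} (hd : Squarefree d) (h : IsSquare (d * k)) :
    ∃ w, k = d * w ^ 2 := by
  obtain ⟨r, hr⟩ := h
  obtain ⟨w, rfl⟩ : d ∣ r := by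
    rw [← hd.dvd_pow_iff_dvd two_ne_zero, sq, ← hr]; exact dvd_mul_right ..
  exact ⟨w, Nat.eq_of_mul_eq_mul_left (Nat.pos_of_ne_zero hd.ne_zero) (by rw [hr]; ring)⟩

theorem isSquare_of_sq_mul {u k : ℕ} (hu : u ≠ 0) (h : IsSquare (u ^ 2 * k)) : IsSquare k := by
  obtain ⟨r, hr⟩ := h
  obtain ⟨w, rfl⟩ : u ∣ r := by
    rw [← Nat.pow_dvd_pow_iff two_ne_zero, sq r, ← hr]; exact dvd_mul_right ..
  exact ⟨w, Nat.eq_of_mul_eq_mul_left (Nat.pos_of_ne_zero (pow_ne_zero 2 hu)) (by rw [hr]; ring)⟩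

theorem isSquare_mul_trans {a b c : ℕ} (hb : b ≠ 0) (hab : IsSquare (a * b))
    (hbc : IsSquare (b * c)) : IsSquare (a * c) :=
  isSquare_of_sq_mul hb (by
    have := hab.mul hbc
    rwa [show a * b * (b * c) = b ^ 2 * (a * c) by ring] at this)

/-- The number of ways to write `e` as an ordered sum of two positive integers whose product is
`k` times a rational square. -/
theorem card_isSquare_mul_le {k e : ℕ} (hk : k ≠ 0) (he : e ≠ 0) (S : Finset (ℕ × ℕ))
    (hS : ∀ q ∈ S, q.1 + q.2 = e ∧ 0 < q.1 ∧ 0 < q.2 ∧ IsSquare (q.1 * q.2 * k)) :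
    #S ≤ 10 * #e.divisors * (#e.divisors * (#k.divisors * #k.divisors)) := by
  choose sf sr hsr hsf using Nat.sq_mul_squarefree
  rw [← Finset.card_product, ← Finset.card_product]
  have hg0 : ∀ q ∈ S, 0 < Nat.gcd q.1 q.2 := fun q hq => Nat.gcd_pos_of_pos_left _ (hS q hq).2.1
  have hdec : ∀ q ∈ S, ∀ g, Nat.gcd q.1 q.2 = g →
      g * (sr (q.1 / g) ^ 2 * sf (q.1 / g)) = q.1 ∧ g * (sr (q.2 / g) ^ 2 * sf (q.2 / g)) = q.2 ∧
      Nat.Coprime (sr (q.1 / g) ^ 2 * sf (q.1 / g)) (sr (q.2 / g) ^ 2 * sf (q.2 / g)) := by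
    rintro q hq g rfl
    rw [hsr, hsr]
    exact ⟨Nat.mul_div_cancel' (Nat.gcd_dvd_left ..), Nat.mul_div_cancel' (Nat.gcd_dvd_right ..),
      Nat.coprime_div_gcd_div_gcd (hg0 q hq)⟩
  -- Write the two parts as `g u² f₁` and `g v² f₂` with `f₁, f₂` squarefree. Coprimality makes
  -- `f₁f₂` squarefree, so it divides `k`. For fixed `(g, f₁, f₂)`, the pair `(u, v)` is a primitive
  -- representation of `e/g` by `f₁u² + f₂v²`.
  refine Finset.card_le_mul_card_image_of_maps_to
    (f := fun q : ℕ × ℕ => (Nat.gcd q.1 q.2, sf (q.1 / Nat.gcd q.1 q.2),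
      sf (q.2 / Nat.gcd q.1 q.2))) ?_ _ ?_
  · intro q hq
    obtain ⟨h1, h2, h3, h4⟩ := hS q hq
    obtain ⟨a, b, c⟩ := hdec q hq _ rfl
    set g := Nat.gcd q.1 q.2 with hg
    set u := sr (q.1 / g)
    set v := sr (q.2 / g)
    set f₁ := sf (q.1 / g) with hf₁
    set f₂ := sf (q.2 / g) with hf₂
    have hsq : Squarefree (f₁ * f₂) :=
      (Nat.squarefree_mul (c.coprime_mul_left.coprime_mul_left_right)).2 ⟨hsf _, hsf _⟩
    have hguv : g * u * v ≠ 0 := by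
      intro h0
      have : q.1 * q.2 = (g * u * v) ^ 2 * (f₁ * f₂) := by
        rw [← a, ← b]; ring
      rw [h0] at this
      have := Nat.mul_pos h2 h3
      rw [zero_pow two_ne_zero, zero_mul] at *
      omega
    have hsquare : IsSquare (f₁ * f₂ * k) := by
      refine isSquare_of_sq_mul hguv ?_
      rw [← a, ← b] at h4
      rwa [show (g * u * v) ^ 2 * (f₁ * f₂ * k) =
        g * (u ^ 2 * f₁) * (g * (v ^ 2 * f₂)) * k by ring]
    obtain ⟨w, hw⟩ := exists_eq_mul_sq hsq hsquare
    have hdvd : f₁ * f₂ ∣ k := ⟨w ^ 2, hw⟩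
    simp only [Finset.mem_product, Nat.mem_divisors]
    refine ⟨⟨?_, he⟩, ⟨(dvd_mul_right _ _).trans hdvd, hk⟩, (dvd_mul_left _ _).trans hdvd, hk⟩
    rw [← h1]
    exact dvd_add (Nat.gcd_dvd_left ..) (Nat.gcd_dvd_right ..)
  · rintro ⟨g, f₁, f₂⟩ _
    set F := S.filter fun q : ℕ × ℕ => (Nat.gcd q.1 q.2, sf (q.1 / Nat.gcd q.1 q.2),
      sf (q.2 / Nat.gcd q.1 q.2)) = (g, f₁, f₂) with hF
    rcases F.eq_empty_or_nonempty with he | ⟨q₁, h₁⟩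
    · rw [he]; simp
    have hmem : ∀ q ∈ F, q ∈ S ∧ g * (sr (q.1 / g) ^ 2 * f₁) = q.1 ∧
        g * (sr (q.2 / g) ^ 2 * f₂) = q.2 ∧
        Nat.Coprime (sr (q.1 / g) ^ 2 * f₁) (sr (q.2 / g) ^ 2 * f₂) := by
      intro q hq
      rw [hF, Finset.mem_filter] at hq
      simp only [Prod.mk.injEq] at hq
      obtain ⟨hq, h1, h2, h3⟩ := hq
      have := hdec q hq g h1
      rw [h1] at h2 h3
      rw [h2, h3] at this
      exact ⟨hq, this⟩
    obtain ⟨hq₁, a₁, b₁, -⟩ := hmem q₁ h₁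
    obtain ⟨hsum, hpos₁, hpos₂, -⟩ := hS q₁ hq₁
    have hg : 0 < g := Nat.pos_of_ne_zero (by rintro rfl; rw [zero_mul] at a₁; omega)
    have hf₁ : 0 < f₁ := Nat.pos_of_ne_zero (by rintro rfl; simp at a₁; omega)
    have hf₂ : 0 < f₂ := Nat.pos_of_ne_zero (by rintro rfl; simp at b₁; omega)
    obtain ⟨M, hM⟩ : g ∣ e := by
      rw [← hsum, ← a₁, ← b₁]; exact dvd_add (dvd_mul_right ..) (dvd_mul_right ..)
    have hinj : Set.InjOn (fun q : ℕ × ℕ => ((sr (q.1 / g) : ℤ), (sr (q.2 / g) : ℤ))) F := by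
      intro q hq q' hq' h
      simp only [Prod.mk.injEq, Nat.cast_inj] at h
      obtain ⟨-, a, b, -⟩ := hmem q hq
      obtain ⟨-, a', b', -⟩ := hmem q' hq'
      exact Prod.ext (by rw [← a, ← a', h.1]) (by rw [← b, ← b', h.2])
    rw [← Finset.card_image_of_injOn hinj]
    refine (card_primitive_form_le (f₁ := f₁) (f₂ := f₂) (M := M) (by exact_mod_cast hf₁)
      (by exact_mod_cast hf₂) _ ?_).trans ?_
    · intro r hr
      obtain ⟨q, hq, rfl⟩ := Finset.mem_image.1 hr
      obtain ⟨hqS, a, b, c⟩ := hmem q hq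
      have hs := (hS q hqS).1
      constructor
      · have : f₁ * sr (q.1 / g) ^ 2 + f₂ * sr (q.2 / g) ^ 2 = M := by
          apply Nat.eq_of_mul_eq_mul_left hg
          rw [← hM, ← hs]
          calc g * (f₁ * sr (q.1 / g) ^ 2 + f₂ * sr (q.2 / g) ^ 2)
              = g * (sr (q.1 / g) ^ 2 * f₁) + g * (sr (q.2 / g) ^ 2 * f₂) := by ring
            _ = _ := by rw [a, b]
        simp only
        exact_mod_cast this
      · simp only
        rw [← Nat.cast_mul, ← Nat.cast_mul, Nat.isCoprime_iff_coprime]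
        refine Nat.Coprime.of_dvd ?_ ?_ c
        · exact ⟨sr (q.1 / g), by ring⟩
        · exact ⟨sr (q.2 / g), by ring⟩
    · rw [Int.natAbs_natCast]
      gcongr
      · exact ⟨_, by rw [hM]; ring⟩

/-! ### Linear independence of square roots -/

/-- A rational linear functional that is the identity on `ℚ` and kills all irrational square
roots of natural numbers. -/
theorem exists_linearMap_sqrt : ∃ φ : ℝ →ₗ[ℚ] ℚ, (∀ q : ℚ, φ q = q) ∧
    ∀ m : ℕ, ¬ IsSquare m → φ √m = 0 := by
  let K := algebraicClosure ℚ ℝ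
  have : Algebra.IsAlgebraic ℚ K := algebraicClosure.isAlgebraic ℚ ℝ
  have : Algebra.IsIntegral ℚ K := Algebra.IsAlgebraic.isIntegral
  -- The normalized trace on the real algebraic numbers, extended linearly to `ℝ`. It kills `√m`
  -- because `X² - m` has no linear term.
  obtain ⟨φ, hφ⟩ := LinearMap.exists_extend (p := Subalgebra.toSubmodule K.toSubalgebra)
    (Algebra.normalizedTrace ℚ K)
  have happ : ∀ x : K, φ x = Algebra.normalizedTrace ℚ K x := fun x => LinearMap.congr_fun hφ x
  refine ⟨φ, fun q => ?_, fun m hm => ?_⟩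
  · have := happ (algebraMap ℚ K q)
    rw [Algebra.normalizedTrace_algebraMap_apply_eq_self] at this
    simpa using this
  · have hint : IsAlgebraic ℚ √(m : ℝ) := by
      refine ⟨Polynomial.X ^ 2 - Polynomial.C (m : ℚ), ?_, ?_⟩
      · exact Polynomial.X_pow_sub_C_ne_zero two_pos _
      · simp
    have hmem : √(m : ℝ) ∈ K := mem_algebraicClosure_iff.2 hint
    have := happ ⟨_, hmem⟩
    rw [this, Algebra.normalizedTrace_minpoly]
    have hmin : minpoly ℚ (⟨√(m : ℝ), hmem⟩ : K) = Polynomial.X ^ 2 - Polynomial.C (m : ℚ) := by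
      symm
      refine minpoly.eq_of_irreducible_of_monic ?_ ?_ ?_
      · rw [X_pow_sub_C_irreducible_iff_of_prime Nat.prime_two]
        intro b hb
        apply hm
        have : IsSquare (m : ℚ) := ⟨b, by rw [← hb, sq]⟩
        exact Rat.isSquare_natCast_iff.1 this
      · apply Subtype.ext
        simp
      · exact Polynomial.monic_X_pow_sub_C _ two_ne_zero
    rw [hmin]
    have : (Polynomial.X ^ 2 - Polynomial.C (m : ℚ)).nextCoeff = 0 := by
      rw [Polynomial.nextCoeff_of_natDegree_pos (by rw [Polynomial.natDegree_X_pow_sub_C]; simp),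
        Polynomial.natDegree_X_pow_sub_C]
      simp
    rw [this]; simp

/-- Equal sums of square roots have equal contributions from each square class. -/
theorem sum_sqrt_squareClass {k a b c a₀ b₀ c₀ : ℕ} (hk : k ≠ 0)
    (h : √(a : ℝ) + √(b : ℝ) + √(c : ℝ) = √(a₀ : ℝ) + √(b₀ : ℝ) + √(c₀ : ℝ)) :
    (if IsSquare (k * a) then √(a : ℝ) else 0) + (if IsSquare (k * b) then √(b : ℝ) else 0) +
      (if IsSquare (k * c) then √(c : ℝ) else 0) =
    (if IsSquare (k * a₀) then √(a₀ : ℝ) else 0) + (if IsSquare (k * b₀) then √(b₀ : ℝ) else 0) +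
      (if IsSquare (k * c₀) then √(c₀ : ℝ) else 0) := by
  obtain ⟨φ, h1, h2⟩ := exists_linearMap_sqrt
  have hk0 : 0 < √(k : ℝ) := Real.sqrt_pos.2 (by positivity)
  -- Multiplying by `√k` makes exactly the square roots in the class of `k` rational, so `φ`
  -- isolates that class.
  have hw : ∀ m : ℕ, ((φ (√(k : ℝ) * √(m : ℝ)) : ℚ) : ℝ) =
      √(k : ℝ) * (if IsSquare (k * m) then √(m : ℝ) else 0) := by
    intro m
    rw [← Real.sqrt_mul (by positivity), ← Nat.cast_mul]
    split_ifs with hs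
    · obtain ⟨r, hr⟩ := hs
      have h3 : √((k * m : ℕ) : ℝ) = (r : ℚ) := by
        rw [hr]; push_cast; exact Real.sqrt_mul_self (by positivity)
      rw [h3, h1, ← h3, Nat.cast_mul, Real.sqrt_mul (by positivity)]
    · rw [h2 _ hs]; simp
  have h3 := congrArg (fun x => ((φ (√(k : ℝ) * x) : ℚ) : ℝ)) h
  simp only [mul_add, map_add, Rat.cast_add, hw] at h3
  exact mul_left_cancel₀ hk0.ne' (by linarith)

/-- Otherwise the class of `a` contributes at least `√a > 0` on the left and nothing on the right.
-/
theorem isSquare_mul_of_sum_sqrt_eq {a b c a₀ b₀ c₀ : ℕ} (ha : a ≠ 0)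
    (h : √(a : ℝ) + √(b : ℝ) + √(c : ℝ) = √(a₀ : ℝ) + √(b₀ : ℝ) + √(c₀ : ℝ)) :
    IsSquare (a * a₀) ∨ IsSquare (a * b₀) ∨ IsSquare (a * c₀) := by
  by_contra! hcon
  have h1 := sum_sqrt_squareClass ha h
  rw [if_neg hcon.1, if_neg hcon.2.1, if_neg hcon.2.2, if_pos ⟨a, rfl⟩] at h1
  have h2 : 0 < √(a : ℝ) := Real.sqrt_pos.2 (by positivity)
  have h3 : ∀ m : ℕ, 0 ≤ if IsSquare (a * m) then √(m : ℝ) else 0 := by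
    intro m; split_ifs <;> positivity
  linarith [h3 b, h3 c]

/-! ### Side triples with a given perimeter -/

theorem card_isSquare_mul_const_le {m N : ℕ} (hm : m ≠ 0) (S : Finset ℕ)
    (hS : ∀ a ∈ S, 0 < a ∧ a ≤ 2 * N ^ 2 ∧ IsSquare (a * m)) : #S ≤ 2 * N := by
  obtain ⟨d, b, rfl, hd⟩ := Nat.sq_mul_squarefree m
  have hd0 : 0 < d := Nat.pos_of_ne_zero hd.ne_zero
  have hw : ∀ a ∈ S, ∃ w, a = d * w ^ 2 := fun a ha =>
    exists_eq_mul_sq hd (isSquare_of_sq_mul (u := b) (by rintro rfl; simp at hm) (by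
      have := (hS a ha).2.2
      rwa [show a * (b ^ 2 * d) = b ^ 2 * (d * a) by ring] at this))
  choose! w hw using hw
  have : #(Finset.Icc 1 (2 * N)) = 2 * N := by simp
  rw [← this]
  refine Finset.card_le_card_of_injOn w (fun a ha => ?_) fun a ha a' ha' h => ?_
  · obtain ⟨h1, h2, -⟩ := hS a ha
    have h3 := hw a ha
    rw [h3] at h1 h2
    refine Finset.mem_coe.2 (Finset.mem_Icc.2 ⟨?_, ?_⟩)
    · by_contra h0
      rw [show w a = 0 by omega] at h1
      simp at h1
    · nlinarith
  · rw [hw a ha, hw a' ha', h]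

/-- Triples with a given sum of square roots, the last member of which is alone in its
square class. -/
theorem card_triples_alone_le {N : ℕ} {p : ℝ} (S : Finset (ℕ × ℕ × ℕ))
    (hS : ∀ q ∈ S, (0 < q.1 ∧ q.1 ≤ 2 * N ^ 2) ∧ 0 < q.2.1 ∧ 0 < q.2.2 ∧
      √(q.1 : ℝ) + √(q.2.1 : ℝ) + √(q.2.2 : ℝ) = p ∧
      ¬ IsSquare (q.2.2 * q.1) ∧ ¬ IsSquare (q.2.2 * q.2.1)) : #S ≤ 48 * N := by
  rcases S.eq_empty_or_nonempty with rfl | ⟨⟨a₀, b₀, c₀⟩, h₀⟩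
  · simp
  obtain ⟨⟨ha0, -⟩, hb0, hc0, hp0, -⟩ := hS _ h₀
  simp only at ha0 hb0 hc0 hp0
  set A : ℕ → Finset ℕ := fun m => (Finset.Icc 1 (2 * N ^ 2)).filter fun a => IsSquare (a * m)
  have hA : ∀ m, m ≠ 0 → #(A m) ≤ 2 * N := fun m hm =>
    card_isSquare_mul_const_le hm _ fun a ha => by
      simp only [A, Finset.mem_filter, Finset.mem_Icc] at ha
      exact ⟨ha.1.1, ha.1.2, ha.2⟩
  have hcard : #((Finset.univ : Finset (Bool × Bool × Bool)) ×ˢ (A a₀ ∪ A b₀ ∪ A c₀)) ≤ 48 * N := by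
    rw [Finset.card_product]
    have h1 : #(Finset.univ : Finset (Bool × Bool × Bool)) = 8 := by decide
    have h2 := Finset.card_union_le (A a₀ ∪ A b₀) (A c₀)
    have h3 := Finset.card_union_le (A a₀) (A b₀)
    have h4 := hA a₀ ha0.ne'
    have h5 := hA b₀ hb0.ne'
    have h6 := hA c₀ hc0.ne'
    rw [h1]
    omega
  -- The three truth values say which reference sides share the class of the lone side, and so fix
  -- its length; the perimeter then gives the remaining side. The first side lies in one of three
  -- classes of size at most `2N`, whence `8 · 3 · 2N`.
  refine (Finset.card_le_card_of_injOn (fun q => ((decide (IsSquare (q.2.2 * a₀)),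
    decide (IsSquare (q.2.2 * b₀)), decide (IsSquare (q.2.2 * c₀))), q.1)) ?_ ?_).trans hcard
  · intro q hq
    obtain ⟨⟨h1, h2⟩, -, -, h3, -⟩ := hS q hq
    simp only [A, Finset.coe_product, Set.mem_prod, Finset.mem_coe, Finset.mem_univ, true_and,
      Finset.mem_union, Finset.mem_filter, Finset.mem_Icc]
    have := isSquare_mul_of_sum_sqrt_eq h1.ne' (h3.trans hp0.symm)
    tauto
  · rintro ⟨a, b, c⟩ hq ⟨a', b', c'⟩ hq' h
    obtain ⟨-, -, hc, hp, hca, hcb⟩ := hS _ hq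
    obtain ⟨-, -, hc', hp', hca', hcb'⟩ := hS _ hq'
    simp only [Prod.mk.injEq, decide_eq_decide] at h hc hc' hp hp' hca hcb hca' hcb'
    obtain ⟨⟨e1, e2, e3⟩, rfl⟩ := h
    have k1 := sum_sqrt_squareClass hc.ne' (hp.trans hp0.symm)
    have k2 := sum_sqrt_squareClass hc'.ne' (hp'.trans hp0.symm)
    rw [if_neg hca, if_neg hcb, if_pos ⟨c, rfl⟩] at k1
    rw [if_neg hca', if_neg hcb', if_pos ⟨c', rfl⟩] at k2
    simp only [← e1, ← e2, ← e3] at k2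
    have hcc : √(c : ℝ) = √(c' : ℝ) := by linarith
    have hbb : √(b : ℝ) = √(b' : ℝ) := by linarith
    have hinj : ∀ x y : ℕ, √(x : ℝ) = √(y : ℝ) → x = y := fun x y hxy => by
      exact_mod_cast (Real.sqrt_inj (by positivity) (by positivity)).1 hxy
    rw [hinj _ _ hcc, hinj _ _ hbb]

/-- Any two of the three factors add up to twice a positive side, so if one factor is nonpositive
the other two are positive and the product is not. -/
theorem pos_of_heron_pos {x y z : ℤ} (hx : 0 < x) (hy : 0 < y) (hz : 0 < z)
    (h : 0 < (y + z - x) * ((x + z - y) * (x + y - z))) :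
    x < y + z ∧ y < x + z ∧ z < x + y := by
  refine ⟨?_, ?_, ?_⟩ <;> by_contra hc
  · nlinarith [mul_pos (by linarith : 0 < x + z - y) (by linarith : 0 < x + y - z)]
  · nlinarith [mul_pos (by linarith : 0 < y + z - x) (by linarith : 0 < x + y - z)]
  · nlinarith [mul_pos (by linarith : 0 < y + z - x) (by linarith : 0 < x + z - y)]

/-- Triples of squared side lengths of lattice triangles with a given perimeter, all in the same
square class. -/
theorem card_triples_sameClass_le {N D : ℕ} {p : ℝ}
    (hD : ∀ m : ℕ, m ≠ 0 → m ≤ 36 * N ^ 2 → #m.divisors ≤ D) (S : Finset (ℕ × ℕ × ℕ))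
    (hS : ∀ q ∈ S, (0 < q.1 ∧ q.1 ≤ 2 * N ^ 2) ∧ (0 < q.2.1 ∧ q.2.1 ≤ 2 * N ^ 2) ∧
      (0 < q.2.2 ∧ q.2.2 ≤ 2 * N ^ 2) ∧ √(q.1 : ℝ) + √(q.2.1 : ℝ) + √(q.2.2 : ℝ) = p ∧
      IsSquare (q.1 * q.2.1) ∧ IsSquare (q.1 * q.2.2) ∧
      ∃ δ : ℤ, δ ≠ 0 ∧ 4 * (q.1 : ℤ) * q.2.1 = (q.1 + q.2.1 - q.2.2) ^ 2 + 4 * δ ^ 2) :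
    #S ≤ 10 * D * (D * (D * D)) * (2 * N) := by
  rcases S.eq_empty_or_nonempty with rfl | ⟨⟨a₀, b₀, c₀⟩, h₀⟩
  · simp
  obtain ⟨⟨ha0, -⟩, ⟨hb0, -⟩, ⟨hc0, -⟩, hp0, hab0, hac0, -⟩ := hS _ h₀
  simp only at ha0 hb0 hc0 hp0 hab0 hac0
  obtain ⟨d, u, hdu, hd⟩ := Nat.sq_mul_squarefree a₀
  have hu : u ≠ 0 := by rintro rfl; simp at hdu; omega
  have hd0 : 0 < d := Nat.pos_of_ne_zero hd.ne_zero
  -- Equal perimeters force every triple into the class of `a₀`, so a single squarefree `d` serves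
  -- the whole set.
  have hclass : ∀ q ∈ S, ∃ x y z : ℕ, q = (d * x ^ 2, d * y ^ 2, d * z ^ 2) ∧
      0 < x ∧ 0 < y ∧ 0 < z ∧ x ≤ 2 * N ∧ y ≤ 2 * N ∧ z ≤ 2 * N := by
    rintro ⟨a, b, c⟩ hq
    obtain ⟨⟨ha, ha'⟩, ⟨hb, hb'⟩, ⟨hc, hc'⟩, hp, hab, hac, -⟩ := hS _ hq
    simp only at ha hb hc ha' hb' hc' hp hab hac
    have haa : IsSquare (a₀ * a) := by
      rw [mul_comm]
      rcases isSquare_mul_of_sum_sqrt_eq ha.ne' (hp.trans hp0.symm) with h | h | h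
      · exact h
      · exact isSquare_mul_trans hb0.ne' h (by rwa [mul_comm])
      · exact isSquare_mul_trans hc0.ne' h (by rwa [mul_comm])
    have key : ∀ m, 0 < m → m ≤ 2 * N ^ 2 → IsSquare (a₀ * m) →
        ∃ x, m = d * x ^ 2 ∧ 0 < x ∧ x ≤ 2 * N := by
      intro m hm hmN hsq
      rw [← hdu, mul_assoc] at hsq
      obtain ⟨x, rfl⟩ := exists_eq_mul_sq hd (isSquare_of_sq_mul hu hsq)
      refine ⟨x, rfl, Nat.pos_of_ne_zero ?_, by nlinarith⟩
      rintro rfl; simp at hm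
    obtain ⟨x, rfl, hx, hx'⟩ := key a ha ha' haa
    obtain ⟨y, rfl, hy, hy'⟩ := key b hb hb' (isSquare_mul_trans ha.ne' haa hab)
    obtain ⟨z, rfl, hz, hz'⟩ := key c hc hc' (isSquare_mul_trans ha.ne' haa hac)
    exact ⟨x, y, z, rfl, hx, hy, hz, hx', hy', hz'⟩
  choose! x y z hq hx hy hz hx' hy' hz' using hclass
  set s := x (a₀, b₀, c₀) + y (a₀, b₀, c₀) + z (a₀, b₀, c₀) with hs
  have hsd : 0 < √(d : ℝ) := Real.sqrt_pos.2 (by positivity)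
  have hsum' : ∀ q ∈ S, ((x q + y q + z q : ℕ) : ℝ) * √(d : ℝ) = p := by
    intro q hqS
    have h1 := (hS q hqS).2.2.2.1
    rw [hq q hqS] at h1
    have h2 : ∀ w : ℕ, √((d * w ^ 2 : ℕ) : ℝ) = w * √(d : ℝ) := by
      intro w
      push_cast
      rw [Real.sqrt_mul (by positivity), Real.sqrt_sq (by positivity), mul_comm]
    simp only [h2] at h1
    rw [← h1]; push_cast; ring
  have hsum : ∀ q ∈ S, x q + y q + z q = s := by
    intro q hqS
    have := (hsum' q hqS).trans (hsum' _ h₀).symm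
    exact_mod_cast mul_right_cancel₀ hsd.ne' this
  have hs6 : s ≤ 6 * N := by
    have := hx' _ h₀; have := hy' _ h₀; have := hz' _ h₀
    omega
  -- Heron's formula: `δ` is twice the signed area, and `d² s(s-2x)(s-2y)(s-2z) = (2δ)²`.
  have hheron : ∀ q ∈ S, 2 * x q < s ∧ 2 * y q < s ∧ 2 * z q < s ∧
      IsSquare ((s - 2 * y q) * (s - 2 * z q) * (s * (s - 2 * x q))) := by
    intro q hqS
    obtain ⟨δ, hδ, h1⟩ := (hS q hqS).2.2.2.2.2.2
    rw [hq q hqS] at h1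
    have hX : (0 : ℤ) < x q := by exact_mod_cast hx q hqS
    have hY : (0 : ℤ) < y q := by exact_mod_cast hy q hqS
    have hZ : (0 : ℤ) < z q := by exact_mod_cast hz q hqS
    have hsq := hsum q hqS
    push_cast at h1
    have h2 : (d : ℤ) ^ 2 * ((x q + y q + z q) * (((y q : ℤ) + z q - x q) *
        ((x q + z q - y q) * (x q + y q - z q)))) = (2 * δ) ^ 2 := by
      linear_combination h1
    have h3 : 0 < ((y q : ℤ) + z q - x q) * ((x q + z q - y q) * (x q + y q - z q)) := by
      have h4 : 0 < (2 * δ) ^ 2 := by positivity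
      rw [← h2] at h4
      exact pos_of_mul_pos_right (pos_of_mul_pos_right h4 (by positivity)) (by positivity)
    obtain ⟨t1, t2, t3⟩ := pos_of_heron_pos hX hY hZ h3
    have t1' : 2 * x q < s := by omega
    have t2' : 2 * y q < s := by omega
    have t3' : 2 * z q < s := by omega
    refine ⟨t1', t2', t3', isSquare_of_sq_mul hd0.ne' ⟨(2 * δ).natAbs, ?_⟩⟩
    zify
    rw [← sq, sq_abs, ← h2, Nat.cast_sub t1'.le, Nat.cast_sub t2'.le, Nat.cast_sub t3'.le, ← hsq]
    push_cast
    ring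
  have hNcard : #(Finset.Icc 1 (2 * N)) = 2 * N := by simp
  conv_rhs => rw [← hNcard]
  -- Once `x = X` is fixed, `s - 2y` and `s - 2z` sum to `2X`, and their product times `s(s - 2X)`
  -- is a square.
  refine Finset.card_le_mul_card_image_of_maps_to (f := x)
    (fun q hqS => Finset.mem_Icc.2 ⟨hx q hqS, hx' q hqS⟩) _ fun X hX => ?_
  rw [Finset.mem_Icc] at hX
  set F := S.filter fun q => x q = X with hF
  rcases F.eq_empty_or_nonempty with he | ⟨q₁, h₁⟩
  · rw [he]; simp
  rw [hF, Finset.mem_filter] at h₁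
  have hXs : 2 * X < s := by rw [← h₁.2]; exact (hheron _ h₁.1).1
  have hinj : Set.InjOn (fun q => (s - 2 * y q, s - 2 * z q)) F := by
    intro q hqF q' hqF' h
    rw [hF, Finset.mem_coe, Finset.mem_filter] at hqF hqF'
    simp only [Prod.mk.injEq] at h
    have a1 := hheron q hqF.1
    have a2 := hheron q' hqF'.1
    rw [hq q hqF.1, hq q' hqF'.1, hqF.2, hqF'.2, show y q = y q' by omega,
      show z q = z q' by omega]
  rw [← Finset.card_image_of_injOn hinj]
  have hk : s * (s - 2 * X) ≠ 0 := Nat.mul_ne_zero (by omega) (by omega)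
  have hN : X ≤ 2 * N := hX.2
  have hkD : #(s * (s - 2 * X)).divisors ≤ D := by
    refine hD _ hk ?_
    calc s * (s - 2 * X) ≤ (6 * N) * (6 * N) := Nat.mul_le_mul hs6 ((Nat.sub_le _ _).trans hs6)
      _ = _ := by ring
  have heD : #(2 * X).divisors ≤ D := hD _ (by omega) (by nlinarith)
  refine (card_isSquare_mul_le hk (e := 2 * X) (by omega) _ ?_).trans (by gcongr)
  intro r hr
  obtain ⟨q, hqF, rfl⟩ := Finset.mem_image.1 hr
  rw [hF, Finset.mem_filter] at hqF
  obtain ⟨a1, a2, a3, a4⟩ := hheron q hqF.1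
  have := hsum q hqF.1
  rw [hqF.2] at a1 a4 this
  exact ⟨by simp only; omega, by simp only; omega, by simp only; omega, a4⟩

/-- The number of triples of squared side lengths of lattice triangles with a given perimeter. -/
theorem card_triples_le {N D : ℕ} {p : ℝ}
    (hD : ∀ m : ℕ, m ≠ 0 → m ≤ 36 * N ^ 2 → #m.divisors ≤ D) (S : Finset (ℕ × ℕ × ℕ))
    (hS : ∀ q ∈ S, (0 < q.1 ∧ q.1 ≤ 2 * N ^ 2) ∧ (0 < q.2.1 ∧ q.2.1 ≤ 2 * N ^ 2) ∧
      (0 < q.2.2 ∧ q.2.2 ≤ 2 * N ^ 2) ∧ √(q.1 : ℝ) + √(q.2.1 : ℝ) + √(q.2.2 : ℝ) = p ∧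
      ∃ δ : ℤ, δ ≠ 0 ∧ 4 * (q.1 : ℤ) * q.2.1 = (q.1 + q.2.1 - q.2.2) ^ 2 + 4 * δ ^ 2) :
    #S ≤ 144 * N + 10 * D * (D * (D * D)) * (2 * N) := by
  set S₁ := S.filter fun q => ¬ IsSquare (q.2.2 * q.1) ∧ ¬ IsSquare (q.2.2 * q.2.1) with hS₁
  set S₂ := S.filter fun q => ¬ IsSquare (q.2.1 * q.1) ∧ ¬ IsSquare (q.2.1 * q.2.2) with hS₂
  set S₃ := S.filter fun q => ¬ IsSquare (q.1 * q.2.1) ∧ ¬ IsSquare (q.1 * q.2.2) with hS₃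
  set S₄ := S.filter fun q => IsSquare (q.1 * q.2.1) ∧ IsSquare (q.1 * q.2.2) with hS₄
  -- Among three elements of an equivalence relation, either one is alone in its class or all three
  -- are equivalent.
  have hcover : S ⊆ S₁ ∪ S₂ ∪ S₃ ∪ S₄ := by
    rintro ⟨a, b, c⟩ hq
    obtain ⟨⟨ha, -⟩, ⟨hb, -⟩, ⟨hc, -⟩, -⟩ := hS _ hq
    simp only [hS₁, hS₂, hS₃, hS₄, Finset.mem_union, Finset.mem_filter, hq, true_and]
    simp only at ha hb hc
    have t1 : IsSquare (c * a) → IsSquare (a * b) → IsSquare (c * b) := isSquare_mul_trans ha.ne'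
    have t2 : IsSquare (a * c) → IsSquare (c * b) → IsSquare (a * b) := isSquare_mul_trans hc.ne'
    have t3 : IsSquare (a * b) → IsSquare (b * c) → IsSquare (a * c) := isSquare_mul_trans hb.ne'
    rw [mul_comm b a, mul_comm b c, mul_comm a c] at *
    tauto
  have h1 : #S₁ ≤ 48 * N := card_triples_alone_le (p := p) S₁ fun q hq => by
    rw [hS₁, Finset.mem_filter] at hq
    obtain ⟨a, b, c, d, -⟩ := hS q hq.1
    exact ⟨a, b.1, c.1, d, hq.2⟩
  have h2 : #S₂ ≤ 48 * N := by
    rw [← Finset.card_image_of_injective (f := fun q : ℕ × ℕ × ℕ => (q.1, q.2.2, q.2.1)) S₂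
      (by rintro ⟨a, b, c⟩ ⟨a', b', c'⟩ h; simp only [Prod.mk.injEq] at h ⊢; tauto)]
    refine card_triples_alone_le (p := p) _ fun r hr => ?_
    obtain ⟨q, hq, rfl⟩ := Finset.mem_image.1 hr
    rw [hS₂, Finset.mem_filter] at hq
    obtain ⟨a, b, c, d, -⟩ := hS q hq.1
    exact ⟨a, c.1, b.1, by simp only; linarith, hq.2⟩
  have h3 : #S₃ ≤ 48 * N := by
    rw [← Finset.card_image_of_injective (f := fun q : ℕ × ℕ × ℕ => (q.2.1, q.2.2, q.1)) S₃
      (by rintro ⟨a, b, c⟩ ⟨a', b', c'⟩ h; simp only [Prod.mk.injEq] at h ⊢; tauto)]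
    refine card_triples_alone_le (p := p) _ fun r hr => ?_
    obtain ⟨q, hq, rfl⟩ := Finset.mem_image.1 hr
    rw [hS₃, Finset.mem_filter] at hq
    obtain ⟨a, b, c, d, -⟩ := hS q hq.1
    exact ⟨b, c.1, a.1, by simp only; linarith, hq.2⟩
  have h4 : #S₄ ≤ 10 * D * (D * (D * D)) * (2 * N) :=
    card_triples_sameClass_le (p := p) hD S₄ fun q hq => by
      rw [hS₄, Finset.mem_filter] at hq
      obtain ⟨a, b, c, d, e⟩ := hS q hq.1
      exact ⟨a, b, c, d, hq.2.1, hq.2.2, e⟩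
  have u0 := Finset.card_le_card hcover
  have u1 := Finset.card_union_le (S₁ ∪ S₂ ∪ S₃) S₄
  have u2 := Finset.card_union_le (S₁ ∪ S₂) S₃
  have u3 := Finset.card_union_le S₁ S₂
  omega

/-! ### Lattice triangles and the upper bound -/

/-- The integer point `v`, as a point of the Euclidean plane. -/
noncomputable def latticePoint (v : ℤ × ℤ) : Plane := !₂[(v.1 : ℝ), (v.2 : ℝ)]

/-- The squared distance of two integer points. -/
def sqDist (v w : ℤ × ℤ) : ℕ := ((v.1 - w.1) ^ 2 + (v.2 - w.2) ^ 2).natAbs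

/-- Twice the signed area of a lattice triangle. -/
def twiceArea (A B C : ℤ × ℤ) : ℤ :=
  (B.1 - A.1) * (C.2 - A.2) - (B.2 - A.2) * (C.1 - A.1)

theorem coe_sqDist (v w : ℤ × ℤ) : (sqDist v w : ℤ) = (v.1 - w.1) ^ 2 + (v.2 - w.2) ^ 2 := by
  rw [sqDist, Int.natCast_natAbs, abs_of_nonneg (by positivity)]

theorem dist_latticePoint (v w : ℤ × ℤ) :
    dist (latticePoint v) (latticePoint w) = √(sqDist v w : ℝ) := by
  have h : (sqDist v w : ℝ) = ((v.1 : ℝ) - w.1) ^ 2 + ((v.2 : ℝ) - w.2) ^ 2 := by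
    exact_mod_cast coe_sqDist v w
  rw [EuclideanSpace.dist_eq, h]
  simp [latticePoint, Real.dist_eq, sq_abs]

theorem affineIndependent_latticePoint (A B C : ℤ × ℤ) :
    AffineIndependent ℝ ![latticePoint A, latticePoint B, latticePoint C] ↔
      twiceArea A B C ≠ 0 := by
  have hli : AffineIndependent ℝ ![latticePoint A, latticePoint B, latticePoint C] ↔
      LinearIndependent ℝ ![latticePoint B - latticePoint A, latticePoint C - latticePoint A] := by
    rw [affineIndependent_iff_linearIndependent_vsub ℝ _ (0 : Fin 3),
      ← linearIndependent_equiv (finSuccAboveEquiv (0 : Fin 3))]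
    have : ((fun i : {x : Fin 3 // x ≠ 0} =>
        (![latticePoint A, latticePoint B, latticePoint C] i -ᵥ
          ![latticePoint A, latticePoint B, latticePoint C] 0 : Plane)) ∘
        (finSuccAboveEquiv (0 : Fin 3))) =
        ![latticePoint B - latticePoint A, latticePoint C - latticePoint A] := by
      ext i
      fin_cases i <;> simp [finSuccAboveEquiv_apply]
    rw [this]
  rw [hli, LinearIndependent.pair_iff]
  have hcoord : ∀ s t : ℝ, s • (latticePoint B - latticePoint A) +
      t • (latticePoint C - latticePoint A) = 0 ↔
      s * ((B.1 : ℝ) - A.1) + t * ((C.1 : ℝ) - A.1) = 0 ∧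
      s * ((B.2 : ℝ) - A.2) + t * ((C.2 : ℝ) - A.2) = 0 := by
    intro s t
    constructor
    · intro h
      have h0 := congrArg (fun v : Plane => v 0) h
      have h1 := congrArg (fun v : Plane => v 1) h
      simp [latticePoint] at h0 h1
      exact ⟨h0, h1⟩
    · rintro ⟨h0, h1⟩
      ext i
      fin_cases i
      · simpa [latticePoint] using h0
      · simpa [latticePoint] using h1
  simp only [hcoord]
  constructor
  · intro h hz
    have hz' : ((B.1 : ℝ) - A.1) * (C.2 - A.2) - (B.2 - A.2) * (C.1 - A.1) = 0 := by
      exact_mod_cast hz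
    -- If the determinant vanishes, each coordinate supplies a linear relation; independence makes
    -- its coefficients zero, so `B = A`, contradicting independence.
    have h1 := h (C.1 - A.1) (-(B.1 - A.1)) ⟨by ring, by linear_combination -hz'⟩
    have h2 := h (C.2 - A.2) (-(B.2 - A.2)) ⟨by linear_combination hz', by ring⟩
    have h3 := h 1 0 ⟨by linarith [h1.2], by linarith [h2.2]⟩
    exact one_ne_zero h3.1
  · rintro h s t ⟨h0, h1⟩
    have hz' : ((B.1 : ℝ) - A.1) * (C.2 - A.2) - (B.2 - A.2) * (C.1 - A.1) ≠ 0 := by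
      exact_mod_cast h
    constructor
    · refine (mul_eq_zero.1 (?_ : s * _ = 0)).resolve_right hz'
      linear_combination (C.2 - A.2 : ℝ) * h0 - (C.1 - A.1 : ℝ) * h1
    · refine (mul_eq_zero.1 (?_ : t * _ = 0)).resolve_right hz'
      linear_combination (B.1 - A.1 : ℝ) * h1 - (B.2 - A.2 : ℝ) * h0

theorem mem_grid_iff {N : ℕ} {v : Plane} :
    v ∈ grid N ↔ ∃ w ∈ Finset.Icc (1 : ℤ) N ×ˢ Finset.Icc (1 : ℤ) N, v = latticePoint w := by
  constructor
  · rintro ⟨i, hi, j, hj, rfl⟩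
    rw [Finset.mem_Icc] at hi hj
    refine ⟨((i : ℤ), (j : ℤ)), ?_, by simp [latticePoint]⟩
    simp only [Finset.mem_product, Finset.mem_Icc]
    omega
  · rintro ⟨⟨x, y⟩, h, rfl⟩
    simp only [Finset.mem_product, Finset.mem_Icc] at h
    lift x to ℕ using by omega
    lift y to ℕ using by omega
    exact ⟨x, Finset.mem_Icc.2 (by omega), y, Finset.mem_Icc.2 (by omega), by simp [latticePoint]⟩

open Classical in
/-- The ordered lattice triangles of perimeter `p` in the grid. -/
noncomputable def orderedTriangles (N : ℕ) (p : ℝ) : Finset ((ℤ × ℤ) × (ℤ × ℤ) × (ℤ × ℤ)) :=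
  ((Finset.Icc (1 : ℤ) N ×ˢ Finset.Icc (1 : ℤ) N) ×ˢ (Finset.Icc (1 : ℤ) N ×ˢ Finset.Icc (1 : ℤ) N)
    ×ˢ (Finset.Icc (1 : ℤ) N ×ˢ Finset.Icc (1 : ℤ) N)).filter fun t =>
      twiceArea t.1 t.2.1 t.2.2 ≠ 0 ∧ √(sqDist t.1 t.2.1 : ℝ) + √(sqDist t.2.1 t.2.2 : ℝ) +
        √(sqDist t.2.2 t.1 : ℝ) = p

theorem triangleCount_le_card_orderedTriangles (N : ℕ) (p : ℝ) :
    triangleCount N p ≤ #(orderedTriangles N p) := by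
  classical
  have hsub : trianglesOfPerimeter N p ⊆ ((orderedTriangles N p).image fun t =>
      ({latticePoint t.1, latticePoint t.2.1, latticePoint t.2.2} : Set Plane) :) := by
    rintro T ⟨hT, A, B, C, rfl, hind, hp⟩
    obtain ⟨a, ha, rfl⟩ := mem_grid_iff.1 (hT (by simp : A ∈ _))
    obtain ⟨b, hb, rfl⟩ := mem_grid_iff.1 (hT (by simp : B ∈ _))
    obtain ⟨c, hc, rfl⟩ := mem_grid_iff.1 (hT (by simp : C ∈ _))
    rw [affineIndependent_latticePoint] at hind
    simp only [dist_latticePoint] at hp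
    refine Finset.mem_coe.2 (Finset.mem_image.2 ⟨(a, b, c), ?_, rfl⟩)
    rw [orderedTriangles, Finset.mem_filter]
    exact ⟨Finset.mem_product.2 ⟨ha, Finset.mem_product.2 ⟨hb, hc⟩⟩, hind, hp⟩
  refine (Set.ncard_le_ncard hsub (Finset.finite_toSet _)).trans ?_
  rw [Set.ncard_coe_finset]
  exact Finset.card_image_le

theorem sqDist_bounds {N : ℕ} {v w : ℤ × ℤ}
    (hv : v ∈ Finset.Icc (1 : ℤ) N ×ˢ Finset.Icc (1 : ℤ) N)
    (hw : w ∈ Finset.Icc (1 : ℤ) N ×ˢ Finset.Icc (1 : ℤ) N) (hne : v ≠ w) :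
    0 < sqDist v w ∧ sqDist v w ≤ 2 * N ^ 2 := by
  simp only [Finset.mem_product, Finset.mem_Icc] at hv hw
  zify
  rw [coe_sqDist]
  constructor
  · rcases eq_or_ne v.1 w.1 with h | h
    · have : v.2 - w.2 ≠ 0 := fun h' => hne (Prod.ext h (by linarith))
      positivity
    · have : v.1 - w.1 ≠ 0 := sub_ne_zero.2 h
      positivity
  · have h1 : (v.1 - w.1) ^ 2 ≤ (N : ℤ) ^ 2 := sq_le_sq' (by linarith) (by linarith)
    have h2 : (v.2 - w.2) ^ 2 ≤ (N : ℤ) ^ 2 := sq_le_sq' (by linarith) (by linarith)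
    linarith

/-- A triangle is determined by `A`, its side triple, and the positions of `B` and `C` on two
circles about `A`. Each circle carries at most `10D²` lattice points. -/
theorem card_orderedTriangles_le {N D : ℕ} (p : ℝ)
    (hD : ∀ m : ℕ, m ≠ 0 → m ≤ 36 * N ^ 2 → #m.divisors ≤ D) :
    #(orderedTriangles N p) ≤
      (10 * D * D) * (10 * D * D) * (N ^ 2 * (144 * N + 10 * D * (D * (D * D)) * (2 * N))) := by
  set O := orderedTriangles N p with hO
  set side : (ℤ × ℤ) × (ℤ × ℤ) × (ℤ × ℤ) → ℕ × ℕ × ℕ := fun t =>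
    (sqDist t.1 t.2.1, sqDist t.2.1 t.2.2, sqDist t.2.2 t.1) with hside
  have hmem : ∀ t ∈ O, t.1 ∈ Finset.Icc (1 : ℤ) N ×ˢ Finset.Icc (1 : ℤ) N ∧
      (0 < sqDist t.1 t.2.1 ∧ sqDist t.1 t.2.1 ≤ 2 * N ^ 2) ∧
      (0 < sqDist t.2.1 t.2.2 ∧ sqDist t.2.1 t.2.2 ≤ 2 * N ^ 2) ∧
      (0 < sqDist t.2.2 t.1 ∧ sqDist t.2.2 t.1 ≤ 2 * N ^ 2) ∧
      √(sqDist t.1 t.2.1 : ℝ) + √(sqDist t.2.1 t.2.2 : ℝ) + √(sqDist t.2.2 t.1 : ℝ) = p ∧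
      twiceArea t.1 t.2.1 t.2.2 ≠ 0 := by
    rintro ⟨A, B, C⟩ ht
    rw [hO, orderedTriangles, Finset.mem_filter] at ht
    simp only at ht ⊢
    obtain ⟨hbox, har, hp⟩ := ht
    obtain ⟨hA, hBC⟩ := Finset.mem_product.1 hbox
    obtain ⟨hB, hC⟩ := Finset.mem_product.1 hBC
    refine ⟨hA, sqDist_bounds hA hB ?_, sqDist_bounds hB hC ?_, sqDist_bounds hC hA ?_, hp, har⟩
    all_goals
      rintro rfl
      apply har
      simp only [twiceArea]
      ring
  have hT : #(O.image side) ≤ 144 * N + 10 * D * (D * (D * D)) * (2 * N) := by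
    refine card_triples_le (p := p) hD _ fun r hr => ?_
    obtain ⟨t, ht, rfl⟩ := Finset.mem_image.1 hr
    obtain ⟨-, h1, h2, h3, h4, h5⟩ := hmem t ht
    refine ⟨h1, h2, h3, h4, twiceArea t.1 t.2.1 t.2.2, h5, ?_⟩
    simp only [hside, coe_sqDist, twiceArea]
    ring
  have hbox : #((Finset.Icc (1 : ℤ) N ×ˢ Finset.Icc (1 : ℤ) N) ×ˢ O.image side) ≤
      N ^ 2 * (144 * N + 10 * D * (D * (D * D)) * (2 * N)) := by
    rw [Finset.card_product, Finset.card_product]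
    simp only [Int.card_Icc, add_sub_cancel_right, Int.toNat_natCast]
    rw [sq]
    gcongr
  refine (Finset.card_le_mul_card_image_of_maps_to (f := fun t => (t.1, side t))
    (t := (Finset.Icc (1 : ℤ) N ×ˢ Finset.Icc (1 : ℤ) N) ×ˢ O.image side)
    (fun t ht => Finset.mem_product.2 ⟨(hmem t ht).1, Finset.mem_image_of_mem _ ht⟩)
    ((10 * D * D) * (10 * D * D)) ?_).trans (Nat.mul_le_mul_left _ hbox)
  rintro ⟨A, a, b, c⟩ -
  set F := O.filter fun t => (t.1, side t) = (A, a, b, c) with hF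
  rcases F.eq_empty_or_nonempty with he | ⟨t₁, h₁⟩
  · rw [he]; simp
  have hFm : ∀ t ∈ F, t ∈ O ∧ t.1 = A ∧ sqDist t.1 t.2.1 = a ∧ sqDist t.2.2 t.1 = c := by
    intro t ht
    rw [hF, Finset.mem_filter] at ht
    simp only [hside, Prod.mk.injEq] at ht
    tauto
  have hrep : ∀ m : ℕ, 0 < m → m ≤ 2 * N ^ 2 → ∀ S : Finset (ℤ × ℤ),
      (∀ q ∈ S, q.1 ^ 2 + q.2 ^ 2 = (m : ℤ)) → #S ≤ 10 * D * D := by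
    intro m hm hm' S hS
    have := hD m hm.ne' (by omega)
    exact (card_sq_add_sq_le hm.ne' S hS).trans (by gcongr)
  obtain ⟨h1O, -, rfl, rfl⟩ := hFm t₁ h₁
  obtain ⟨-, ha, -, hc, -⟩ := hmem t₁ h1O
  have hB := hrep _ ha.1 ha.2 (F.image fun t => (t.1.1 - t.2.1.1, t.1.2 - t.2.1.2)) (by
    intro q hq
    obtain ⟨t, ht, rfl⟩ := Finset.mem_image.1 hq
    rw [← (hFm t ht).2.2.1, coe_sqDist])
  have hC := hrep _ hc.1 hc.2 (F.image fun t => (t.2.2.1 - t.1.1, t.2.2.2 - t.1.2)) (by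
    intro q hq
    obtain ⟨t, ht, rfl⟩ := Finset.mem_image.1 hq
    rw [← (hFm t ht).2.2.2, coe_sqDist])
  refine le_trans ?_ (Nat.mul_le_mul hB hC)
  rw [← Finset.card_product]
  refine Finset.card_le_card_of_injOn (fun t => ((t.1.1 - t.2.1.1, t.1.2 - t.2.1.2),
    (t.2.2.1 - t.1.1, t.2.2.2 - t.1.2))) (fun t ht => ?_) ?_
  · exact Finset.mem_coe.2 (Finset.mem_product.2
      ⟨Finset.mem_image_of_mem _ ht, Finset.mem_image_of_mem _ ht⟩)
  · rintro ⟨⟨x, y⟩, ⟨x₁, y₁⟩, ⟨x₂, y₂⟩⟩ ht ⟨⟨x', y'⟩, ⟨x₁', y₁'⟩, ⟨x₂', y₂'⟩⟩ ht' h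
    have e1 := (hFm _ ht).2.1
    have e2 := (hFm _ ht').2.1
    rw [← e2] at e1
    simp only [Prod.mk.injEq] at h e1 ⊢
    omega

/-- The scale `X` is kept apart from `N` because for the grid of side `⌊√n⌋` the error exponent is
expressed through `n`. The eight divisor factors are four from the two circles and four from the
side triples. -/
theorem exists_triangleCount_le : ∃ C c : ℝ, 0 < C ∧ 0 < c ∧ ∀ X : ℕ, 3 ≤ X → ∀ N : ℕ, N ≤ X →
    ∀ p : ℝ, (triangleCount N p : ℝ) ≤
      C * (N : ℝ) ^ 3 * (X : ℝ) ^ (c / Real.log (Real.log X)) := by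
  obtain ⟨c, hc, hdiv⟩ := exists_card_divisors_le
  refine ⟨16400, 8 * c, by norm_num, by positivity, fun X hX N hNX p => ?_⟩
  set E := (X : ℝ) ^ (c / Real.log (Real.log X)) with hE
  have hE0 : 0 ≤ E := by positivity
  have hX6 : ∀ m : ℕ, m ≤ 36 * N ^ 2 → m ≤ X ^ 6 := fun m hm => by
    calc m ≤ 36 * N ^ 2 := hm
      _ ≤ 3 ^ 4 * X ^ 2 := by gcongr; norm_num
      _ ≤ X ^ 4 * X ^ 2 := by gcongr
      _ = X ^ 6 := by ring
  have hD : ∀ m : ℕ, m ≠ 0 → m ≤ 36 * N ^ 2 → #m.divisors ≤ ⌊E⌋₊ := fun m hm hm' =>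
    Nat.le_floor (hdiv X hX m hm (hX6 m hm'))
  set D := ⌊E⌋₊ with hDdef
  have hD1 : 1 ≤ D := Nat.le_floor (by
    have := hdiv X hX 1 one_ne_zero (Nat.one_le_pow _ _ (by omega))
    simpa using this)
  have h1 := (triangleCount_le_card_orderedTriangles N p).trans (card_orderedTriangles_le p hD)
  have h2 : (10 * D * D) * (10 * D * D) * (N ^ 2 * (144 * N + 10 * D * (D * (D * D)) * (2 * N))) ≤
      16400 * N ^ 3 * D ^ 8 := by
    have h4 : 1 ≤ D ^ 4 := Nat.one_le_pow _ _ hD1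
    calc (10 * D * D) * (10 * D * D) * (N ^ 2 * (144 * N + 10 * D * (D * (D * D)) * (2 * N)))
        = 100 * D ^ 4 * N ^ 3 * (144 * 1 + 20 * D ^ 4) := by ring
      _ ≤ 100 * D ^ 4 * N ^ 3 * (144 * D ^ 4 + 20 * D ^ 4) := by gcongr
      _ = _ := by ring
  have h3 : (triangleCount N p : ℝ) ≤ 16400 * (N : ℝ) ^ 3 * (D : ℝ) ^ 8 := by
    exact_mod_cast h1.trans h2
  have h4 : (X : ℝ) ^ (8 * c / Real.log (Real.log X)) = E ^ 8 := by
    rw [hE, ← Real.rpow_natCast, ← Real.rpow_mul (by positivity)]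
    congr 1; push_cast; ring
  rw [h4]
  refine h3.trans ?_
  gcongr
  exact Nat.floor_le hE0

/-! ### The lower bound construction -/

/-- A complex number with positive real part is determined by its square: equal squares have equal
norms, which fixes the real part and then the imaginary part. -/
theorem eq_of_complex_sq_eq {a b c d : ℤ} (ha : 0 < a) (hc : 0 < c)
    (h1 : a ^ 2 - b ^ 2 = c ^ 2 - d ^ 2) (h2 : a * b = c * d) : a = c ∧ b = d := by
  have h3 : (a ^ 2 + b ^ 2) ^ 2 = (c ^ 2 + d ^ 2) ^ 2 := by
    linear_combination (a ^ 2 - b ^ 2 + (c ^ 2 - d ^ 2)) * h1 + 4 * (a * b + c * d) * h2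
  have h4 : a ^ 2 + b ^ 2 = c ^ 2 + d ^ 2 := (sq_eq_sq₀ (by positivity) (by positivity)).1 h3
  have h5 : a = c := (sq_eq_sq₀ ha.le hc.le).1 (by linarith)
  subst h5
  exact ⟨rfl, mul_left_cancel₀ ha.ne' h2⟩

/-- The real part of `μ ρ`, where `μ = k.1 + i k.2.1` and `ρ = k.2.2.1 + i k.2.2.2`. -/
def prodRe (k : ℤ × ℤ × ℤ × ℤ) : ℤ := k.1 * k.2.2.1 - k.2.1 * k.2.2.2

/-- The imaginary part of `μ ρ`. -/
def prodIm (k : ℤ × ℤ × ℤ × ℤ) : ℤ := k.1 * k.2.2.2 + k.2.1 * k.2.2.1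

/-- The real part of `μ² + ρ²`. -/
def sumRe (k : ℤ × ℤ × ℤ × ℤ) : ℤ := k.1 ^ 2 - k.2.1 ^ 2 + k.2.2.1 ^ 2 - k.2.2.2 ^ 2

/-- The imaginary part of `μ² + ρ²`. -/
def sumIm (k : ℤ × ℤ × ℤ × ℤ) : ℤ := 2 * (k.1 * k.2.1 + k.2.2.1 * k.2.2.2)

/-- The vertex `A + (2 μ ρ)²`. -/
def vertexB (A : ℤ × ℤ) (k : ℤ × ℤ × ℤ × ℤ) : ℤ × ℤ :=
  (A.1 + 4 * (prodRe k ^ 2 - prodIm k ^ 2), A.2 + 8 * (prodRe k * prodIm k))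

/-- The vertex `A + (μ² + ρ²)²`. -/
def vertexC (A : ℤ × ℤ) (k : ℤ × ℤ × ℤ × ℤ) : ℤ × ℤ :=
  (A.1 + (sumRe k ^ 2 - sumIm k ^ 2), A.2 + 2 * (sumRe k * sumIm k))

/-- `|μ|² + |ρ|²`. -/
def normSum (k : ℤ × ℤ × ℤ × ℤ) : ℤ := k.1 ^ 2 + k.2.1 ^ 2 + k.2.2.1 ^ 2 + k.2.2.2 ^ 2

theorem sqrt_sqDist_eq {v w : ℤ × ℤ} {r : ℤ} (hr : 0 ≤ r)
    (h : (v.1 - w.1) ^ 2 + (v.2 - w.2) ^ 2 = r ^ 2) : √(sqDist v w : ℝ) = r := by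
  have h1 : (sqDist v w : ℝ) = (r : ℝ) ^ 2 := by
    have := coe_sqDist v w
    rw [h] at this
    exact_mod_cast this
  rw [h1, Real.sqrt_sq (by exact_mod_cast hr)]

/-- By the parallelogram law for `μ²` and `ρ²`, the perimeter only depends on `|μ|² + |ρ|²`. -/
theorem perimeter_family (A : ℤ × ℤ) (k : ℤ × ℤ × ℤ × ℤ) :
    √(sqDist A (vertexB A k) : ℝ) + √(sqDist (vertexB A k) (vertexC A k) : ℝ) +
      √(sqDist (vertexC A k) A : ℝ) = 2 * (normSum k : ℝ) ^ 2 := by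
  obtain ⟨m, n, p, q⟩ := k
  rw [sqrt_sqDist_eq (r := 4 * (m ^ 2 + n ^ 2) * (p ^ 2 + q ^ 2)) (by positivity),
    sqrt_sqDist_eq (r := (m ^ 2 - n ^ 2 - p ^ 2 + q ^ 2) ^ 2 + (2 * (m * n - p * q)) ^ 2)
      (by positivity),
    sqrt_sqDist_eq (r := (m ^ 2 - n ^ 2 + p ^ 2 - q ^ 2) ^ 2 + (2 * (m * n + p * q)) ^ 2)
      (by positivity)]
  · simp only [normSum]; push_cast; ring
  all_goals
    simp only [vertexB, vertexC, prodRe, prodIm, sumRe, sumIm]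
    ring

/-- The range of the parameters `μ`, `ρ`. -/
noncomputable def parameterBox (R : ℕ) : Finset (ℤ × ℤ × ℤ × ℤ) :=
  Finset.Ioc (8 * R : ℤ) (9 * R) ×ˢ Finset.Ioc (0 : ℤ) R ×ˢ Finset.Ioc (4 * R : ℤ) (5 * R) ×ˢ
    Finset.Ioc (R : ℤ) (2 * R)

theorem card_parameterBox (R : ℕ) : #(parameterBox R) = R ^ 4 := by
  simp only [parameterBox, Finset.card_product, Int.card_Ioc]
  rw [show (9 * R - 8 * R : ℤ) = R by ring, show (5 * R - 4 * R : ℤ) = R by ring,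
    show (2 * R - R : ℤ) = R by ring, sub_zero, Int.toNat_natCast]
  ring

/-- The box is chosen so that `μ ± ρ`, `μρ` and `μ² + ρ²` all have positive real part, which lets
square roots be taken uniquely. The last two inequalities give nonzero area and put `C` to the right
of `B`. -/
theorem parameterBox_bounds {R : ℕ} {k : ℤ × ℤ × ℤ × ℤ} (hk : k ∈ parameterBox R) :
    (0 < k.1 - k.2.2.1 ∧ 0 < k.1 + k.2.2.1) ∧
    30 * (R : ℤ) ^ 2 ≤ prodRe k ∧ prodRe k ≤ 45 * (R : ℤ) ^ 2 ∧
    0 < prodIm k ∧ prodIm k ≤ 23 * (R : ℤ) ^ 2 ∧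
    75 * (R : ℤ) ^ 2 ≤ sumRe k ∧ sumRe k ≤ 106 * (R : ℤ) ^ 2 ∧
    0 < sumIm k ∧ sumIm k ≤ 38 * (R : ℤ) ^ 2 ∧
    (0 ≤ normSum k ∧ normSum k ≤ 111 * (R : ℤ) ^ 2) ∧
    prodRe k * sumIm k - prodIm k * sumRe k < 0 ∧
    4 * (prodRe k ^ 2 - prodIm k ^ 2) < sumRe k ^ 2 - sumIm k ^ 2 := by
  obtain ⟨m, n, p, q⟩ := k
  simp only [parameterBox, Finset.mem_product, Finset.mem_Ioc] at hk
  obtain ⟨⟨m1, m2⟩, ⟨n1, n2⟩, ⟨p1, p2⟩, ⟨q1, q2⟩⟩ := hk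
  simp only [prodRe, prodIm, sumRe, sumIm, normSum]
  have hR : (0 : ℤ) < R := by linarith
  set r : ℤ := (R : ℤ)
  have hm : 0 < m := by linarith
  have hp : 0 < p := by linarith
  have hq : 0 < q := by linarith
  have mp1 : 32 * r ^ 2 ≤ m * p := by
    calc 32 * r ^ 2 = (8 * r) * (4 * r) := by ring
      _ ≤ _ := by gcongr
  have mp2 : m * p ≤ 45 * r ^ 2 := by
    calc m * p ≤ (9 * r) * (5 * r) := by gcongr
      _ = _ := by ring
  have nq1 : 0 < n * q := mul_pos n1 (by linarith)
  have nq2 : n * q ≤ 2 * r ^ 2 := by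
    calc n * q ≤ r * (2 * r) := by gcongr
      _ = _ := by ring
  have mq1 : 8 * r ^ 2 < m * q := by
    calc 8 * r ^ 2 = (8 * r) * r := by ring
      _ < m * q := by gcongr
  have mq2 : m * q ≤ 18 * r ^ 2 := by
    calc m * q ≤ (9 * r) * (2 * r) := by gcongr
      _ = _ := by ring
  have np1 : 0 < n * p := mul_pos n1 (by linarith)
  have np2 : n * p ≤ 5 * r ^ 2 := by
    calc n * p ≤ r * (5 * r) := by gcongr
      _ = _ := by ring
  have mn1 : 0 < m * n := mul_pos (by linarith) n1
  have mn2 : m * n ≤ 9 * r ^ 2 := by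
    calc m * n ≤ (9 * r) * r := by gcongr
      _ = _ := by ring
  have pq1 : 0 < p * q := mul_pos (by linarith) (by linarith)
  have pq2 : p * q ≤ 10 * r ^ 2 := by
    calc p * q ≤ (5 * r) * (2 * r) := by gcongr
      _ = _ := by ring
  have mm1 : 64 * r ^ 2 ≤ m ^ 2 := by
    calc 64 * r ^ 2 = (8 * r) ^ 2 := by ring
      _ ≤ _ := by gcongr
  have mm2 : m ^ 2 ≤ 81 * r ^ 2 := by
    calc m ^ 2 ≤ (9 * r) ^ 2 := by gcongr
      _ = _ := by ring
  have nn1 : 0 < n ^ 2 := by positivity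
  have nn2 : n ^ 2 ≤ r ^ 2 := by gcongr
  have pp1 : 16 * r ^ 2 ≤ p ^ 2 := by
    calc 16 * r ^ 2 = (4 * r) ^ 2 := by ring
      _ ≤ _ := by gcongr
  have pp2 : p ^ 2 ≤ 25 * r ^ 2 := by
    calc p ^ 2 ≤ (5 * r) ^ 2 := by gcongr
      _ = _ := by ring
  have qq1 : r ^ 2 ≤ q ^ 2 := by gcongr
  have qq2 : q ^ 2 ≤ 4 * r ^ 2 := by
    calc q ^ 2 ≤ (2 * r) ^ 2 := by gcongr
      _ = _ := by ring
  have rr : 0 < r ^ 2 := by positivity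
  refine ⟨⟨by linarith, by linarith⟩, by linarith, by linarith, by linarith, by linarith,
    by linarith, by linarith, by linarith, by linarith, ⟨by linarith, by linarith⟩, ?_, ?_⟩
  -- The left side is the imaginary part of `conj(μρ)(μ² + ρ²)`, which equals `(|μ|² - |ρ|²) Im(μ
  -- conj ρ)`.
  · have h1 : (m * p - n * q) * (2 * (m * n + p * q)) -
        (m * q + n * p) * (m ^ 2 - n ^ 2 + p ^ 2 - q ^ 2) =
        -((m * q - n * p) * (m ^ 2 + n ^ 2 - p ^ 2 - q ^ 2)) := by ring
    rw [h1, neg_lt_zero]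
    exact mul_pos (by linarith) (by linarith)
  -- Real part of `(μ² + ρ²)² - (2μρ)² = (μ² - ρ²)²`.
  · have h2 : (m ^ 2 - n ^ 2 + p ^ 2 - q ^ 2) ^ 2 - (2 * (m * n + p * q)) ^ 2 -
        4 * ((m * p - n * q) ^ 2 - (m * q + n * p) ^ 2) =
        (m ^ 2 - n ^ 2 - p ^ 2 + q ^ 2) ^ 2 - (2 * (m * n - p * q)) ^ 2 := by ring
    have h3 : (2 * (m * n - p * q)) ^ 2 < (m ^ 2 - n ^ 2 - p ^ 2 + q ^ 2) ^ 2 :=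
      sq_lt_sq' (by linarith) (by linarith)
    linarith

theorem eq_of_insert_eq {a b c a' b' c' : ℤ × ℤ} (h1 : a.1 < b.1) (h2 : b.1 < c.1)
    (h1' : a'.1 < b'.1) (h2' : b'.1 < c'.1)
    (h : ({a, b, c} : Set (ℤ × ℤ)) = {a', b', c'}) : a = a' ∧ b = b' ∧ c = c' := by
  have ha : a ∈ ({a', b', c'} : Set (ℤ × ℤ)) := by rw [← h]; simp
  have hb : b ∈ ({a', b', c'} : Set (ℤ × ℤ)) := by rw [← h]; simp
  have hc : c ∈ ({a', b', c'} : Set (ℤ × ℤ)) := by rw [← h]; simp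
  simp only [Set.mem_insert_iff, Set.mem_singleton_iff] at ha hb hc
  rcases ha with rfl | rfl | rfl <;> rcases hb with rfl | rfl | rfl <;>
    rcases hc with rfl | rfl | rfl <;> first | exact ⟨rfl, rfl, rfl⟩ | omega

theorem latticePoint_injective : Function.Injective latticePoint := by
  intro v w h
  have h0 := congrArg (fun v : Plane => v 0) h
  have h1 := congrArg (fun v : Plane => v 1) h
  simp only [latticePoint, PiLp.toLp_apply, Matrix.cons_val_zero, Matrix.cons_val_one,
    Int.cast_inj] at h0 h1
  exact Prod.ext h0 h1

theorem exists_triangleCount_ge {R M N : ℕ} (hR : 0 < R) (hN : M + 12000 * R ^ 4 ≤ N) :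
    ∃ p : ℝ, 0 < p ∧ (M : ℝ) ^ 2 * (R : ℝ) ^ 2 / 112 ≤ triangleCount N p := by
  set J := (Finset.Icc (1 : ℤ) M ×ˢ Finset.Icc (1 : ℤ) M) ×ˢ parameterBox R with hJ
  have hJcard : #J = M ^ 2 * R ^ 4 := by
    rw [hJ, Finset.card_product, Finset.card_product, card_parameterBox]
    simp only [Int.card_Icc, add_sub_cancel_right, Int.toNat_natCast]
    ring
  have hR1 : (1 : ℝ) ≤ R := by exact_mod_cast hR
  have hRZ : (1 : ℤ) ≤ R := by exact_mod_cast hR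
  -- Pigeonhole: `M² R⁴` choices of anchor and parameters against at most `111R² + 1 ≤ 112R²` values
  -- of `normSum`.
  obtain ⟨t, -, ht⟩ := Finset.exists_le_card_fiber_of_nsmul_le_card_of_maps_to
    (s := J) (t := Finset.Icc (0 : ℤ) (111 * R ^ 2)) (f := fun j => normSum j.2)
    (b := (M : ℝ) ^ 2 * (R : ℝ) ^ 2 / 112) (by
      intro j hj
      obtain ⟨-, -, -, -, -, -, -, -, -, h, -⟩ := parameterBox_bounds (Finset.mem_product.1 hj).2
      exact Finset.mem_Icc.2 h) ⟨0, Finset.mem_Icc.2 ⟨le_rfl, by positivity⟩⟩ (by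
      rw [hJcard, nsmul_eq_mul, Int.card_Icc]
      have h1 : ((111 * (R : ℤ) ^ 2 + 1 - 0).toNat : ℝ) ≤ 112 * (R : ℝ) ^ 2 := by
        have : (111 * (R : ℤ) ^ 2 + 1 - 0).toNat = 111 * R ^ 2 + 1 := by
          rw [sub_zero]; exact_mod_cast Int.toNat_natCast (111 * R ^ 2 + 1)
        rw [this]; push_cast; nlinarith
      push_cast
      calc ((111 * (R : ℤ) ^ 2 + 1 - 0).toNat : ℝ) * ((M : ℝ) ^ 2 * (R : ℝ) ^ 2 / 112)
          ≤ 112 * (R : ℝ) ^ 2 * ((M : ℝ) ^ 2 * (R : ℝ) ^ 2 / 112) := by gcongr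
        _ = _ := by ring)
  set F := J.filter fun j => normSum j.2 = t with hF
  rcases F.eq_empty_or_nonempty with he | hne
  · rw [he] at ht
    exact ⟨1, one_pos, ht.trans (by simp)⟩
  have hFm : ∀ j ∈ F, (j.1 ∈ Finset.Icc (1 : ℤ) M ×ˢ Finset.Icc (1 : ℤ) M) ∧
      j.2 ∈ parameterBox R ∧ normSum j.2 = t := by
    intro j hj
    rw [hF, Finset.mem_filter, hJ, Finset.mem_product] at hj
    exact ⟨hj.1.1, hj.1.2, hj.2⟩
  have ht0 : 0 < (t : ℝ) := by
    obtain ⟨j, hj⟩ := hne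
    obtain ⟨-, hk, hkt⟩ := hFm j hj
    have hpos : 0 < j.2.1 + j.2.2.2.1 := (parameterBox_bounds hk).1.2
    have : 0 < t := by
      rw [← hkt, normSum]
      by_contra hcon
      have h1 : j.2.1 ^ 2 = 0 := by
        nlinarith [sq_nonneg j.2.1, sq_nonneg j.2.2.1, sq_nonneg j.2.2.2.1, sq_nonneg j.2.2.2.2]
      have h2 : j.2.2.2.1 ^ 2 = 0 := by
        nlinarith [sq_nonneg j.2.1, sq_nonneg j.2.2.1, sq_nonneg j.2.2.2.1, sq_nonneg j.2.2.2.2]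
      rw [pow_eq_zero_iff two_ne_zero] at h1 h2
      linarith
    exact_mod_cast this
  refine ⟨2 * (t : ℝ) ^ 2, by positivity, ht.trans ?_⟩
  -- The vertices have increasing first coordinates, so the unordered vertex set still reveals which
  -- vertex is which.
  have hx : ∀ j ∈ F, j.1.1 < (vertexB j.1 j.2).1 ∧
      (vertexB j.1 j.2).1 < (vertexC j.1 j.2).1 := by
    intro j hj
    obtain ⟨-, a1, a2, a3, a4, -, -, -, -, -, -, a5⟩ := parameterBox_bounds (hFm j hj).2.1
    simp only [vertexB, vertexC]
    refine ⟨?_, by linarith⟩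
    have : prodIm j.2 ^ 2 < prodRe j.2 ^ 2 := sq_lt_sq' (by nlinarith) (by nlinarith)
    linarith
  have hgrid : ∀ j ∈ F, ∀ v ∈ ({j.1, vertexB j.1 j.2, vertexC j.1 j.2} : Set (ℤ × ℤ)),
      v ∈ Finset.Icc (1 : ℤ) N ×ˢ Finset.Icc (1 : ℤ) N := by
    intro j hj v hv
    obtain ⟨hbox, hk, -⟩ := hFm j hj
    obtain ⟨x1, x2⟩ := hx j hj
    obtain ⟨-, a1, a2, a3, a4, a5, a6, a7, a8, -⟩ := parameterBox_bounds hk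
    have hr2 : (0 : ℤ) < (R : ℤ) ^ 2 := by positivity
    have hr4 : (0 : ℤ) < (R : ℤ) ^ 4 := by positivity
    have b1 : 0 ≤ prodRe j.2 * prodIm j.2 := mul_nonneg (by linarith) a3.le
    have b2 : prodRe j.2 * prodIm j.2 ≤ 1035 * (R : ℤ) ^ 4 := by
      calc prodRe j.2 * prodIm j.2 ≤ (45 * (R : ℤ) ^ 2) * (23 * (R : ℤ) ^ 2) := by gcongr
        _ = _ := by ring
    have b3 : 0 ≤ sumRe j.2 * sumIm j.2 := mul_nonneg (by linarith) a7.le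
    have b4 : sumRe j.2 * sumIm j.2 ≤ 4028 * (R : ℤ) ^ 4 := by
      calc sumRe j.2 * sumIm j.2 ≤ (106 * (R : ℤ) ^ 2) * (38 * (R : ℤ) ^ 2) := by gcongr
        _ = _ := by ring
    have b5 : sumRe j.2 ^ 2 ≤ 11236 * (R : ℤ) ^ 4 := by
      calc sumRe j.2 ^ 2 ≤ (106 * (R : ℤ) ^ 2) ^ 2 := by gcongr; linarith
        _ = _ := by ring
    have b6 := sq_nonneg (sumIm j.2)
    have hN' : (M : ℤ) + 12000 * (R : ℤ) ^ 4 ≤ N := by exact_mod_cast hN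
    simp only [Finset.mem_product, Finset.mem_Icc] at hbox ⊢
    simp only [vertexB, vertexC] at x1 x2 hv
    simp only [Set.mem_insert_iff, Set.mem_singleton_iff] at hv
    rcases hv with rfl | rfl | rfl
    · refine ⟨⟨?_, ?_⟩, ?_, ?_⟩ <;> linarith
    · refine ⟨⟨?_, ?_⟩, ?_, ?_⟩ <;> simp only <;> linarith
    · refine ⟨⟨?_, ?_⟩, ?_, ?_⟩ <;> simp only <;> linarith
  set tri : (ℤ × ℤ) × (ℤ × ℤ × ℤ × ℤ) → Set Plane := fun j =>
    latticePoint '' {j.1, vertexB j.1 j.2, vertexC j.1 j.2} with htri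
  have hmaps : ∀ j ∈ F, tri j ∈ trianglesOfPerimeter N (2 * (t : ℝ) ^ 2) := by
    intro j hj
    obtain ⟨hbox, hk, hkt⟩ := hFm j hj
    refine ⟨?_, latticePoint j.1, latticePoint (vertexB j.1 j.2), latticePoint (vertexC j.1 j.2),
      ?_, ?_, ?_⟩
    · rintro _ ⟨v, hv, rfl⟩
      exact mem_grid_iff.2 ⟨v, hgrid j hj v hv, rfl⟩
    · simp only [htri, Set.image_insert_eq, Set.image_singleton]
    · rw [affineIndependent_latticePoint]
      obtain ⟨-, a1, a2, a3, a4, a5, a6, a7, a8, -, a9, -⟩ := parameterBox_bounds hk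
      have hr2 : (0 : ℤ) < (R : ℤ) ^ 2 := by positivity
      -- For `z = μρ` and `w = μ² + ρ²` this is `4 Im(conj(z)² w²) = 8 Re(conj(z) w) Im(conj(z) w)`.
      have h1 : twiceArea j.1 (vertexB j.1 j.2) (vertexC j.1 j.2) =
          8 * (prodRe j.2 * sumRe j.2 + prodIm j.2 * sumIm j.2) *
            (prodRe j.2 * sumIm j.2 - prodIm j.2 * sumRe j.2) := by
        simp only [twiceArea, vertexB, vertexC]
        ring
      rw [h1]
      have h2 : 0 < prodRe j.2 * sumRe j.2 := mul_pos (by linarith) (by linarith)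
      have h3 : 0 < prodIm j.2 * sumIm j.2 := mul_pos a3 a7
      exact mul_ne_zero (by linarith) a9.ne
    · simp only [dist_latticePoint]
      rw [perimeter_family, hkt]
  have hinj : Set.InjOn tri F := by
    intro j hj j' hj' h
    have h1 := latticePoint_injective.image_injective h
    obtain ⟨x1, x2⟩ := hx j hj
    obtain ⟨x1', x2'⟩ := hx j' hj'
    obtain ⟨hA, hB, hC⟩ := eq_of_insert_eq x1 x2 x1' x2' h1
    obtain ⟨⟨c1, c2⟩, a1, -, -, -, a5, -, -⟩ := parameterBox_bounds (hFm j hj).2.1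
    obtain ⟨⟨c1', c2'⟩, a1', -, -, -, a5', -, -⟩ := parameterBox_bounds (hFm j' hj').2.1
    have hr2 : (0 : ℤ) < (R : ℤ) ^ 2 := by positivity
    obtain ⟨A, m, n, p, q⟩ := j
    obtain ⟨A', m', n', p', q'⟩ := j'
    simp only at hA
    subst hA
    simp only [vertexB, vertexC, Prod.mk.injEq] at hB hC
    -- `B` determines `μρ` and `C` determines `μ² + ρ²`; then `(μ ± ρ)²` are known, hence `μ ± ρ`,
    -- hence `μ` and `ρ`.
    obtain ⟨e1, e2⟩ := eq_of_complex_sq_eq (by linarith) (by linarith)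
      (by linarith [hB.1] : prodRe (m, n, p, q) ^ 2 - prodIm (m, n, p, q) ^ 2 =
        prodRe (m', n', p', q') ^ 2 - prodIm (m', n', p', q') ^ 2) (by linarith [hB.2])
    obtain ⟨e3, e4⟩ := eq_of_complex_sq_eq (by linarith) (by linarith)
      (by linarith [hC.1] : sumRe (m, n, p, q) ^ 2 - sumIm (m, n, p, q) ^ 2 =
        sumRe (m', n', p', q') ^ 2 - sumIm (m', n', p', q') ^ 2) (by linarith [hC.2])
    simp only [prodRe, prodIm, sumRe, sumIm] at e1 e2 e3 e4 c1 c2 c1' c2'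
    obtain ⟨f1, f2⟩ := eq_of_complex_sq_eq (b := n + q) (d := n' + q') c2 c2'
      (by linear_combination e3 + 2 * e1) (by linarith)
    obtain ⟨f3, f4⟩ := eq_of_complex_sq_eq (b := n - q) (d := n' - q') c1 c1'
      (by linear_combination e3 - 2 * e1) (by linarith)
    simp only [Prod.mk.injEq, true_and]
    omega
  have hfin : #F ≤ triangleCount N (2 * (t : ℝ) ^ 2) := by
    rw [triangleCount, ← Set.ncard_coe_finset F, ← hinj.ncard_image]
    refine Set.ncard_le_ncard ?_ (trianglesOfPerimeter_finite _ _)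
    rintro _ ⟨j, hj, rfl⟩
    exact hmaps j hj
  exact_mod_cast hfin

theorem exists_one_le_triangleCount {N : ℕ} (hN : 2 ≤ N) :
    ∃ p : ℝ, 0 < p ∧ 1 ≤ triangleCount N p := by
  set p : ℝ := dist (latticePoint (1, 1)) (latticePoint (2, 1)) +
    dist (latticePoint (2, 1)) (latticePoint (1, 2)) +
    dist (latticePoint (1, 2)) (latticePoint (1, 1)) with hp
  refine ⟨p, ?_, ?_⟩
  · have : 0 < dist (latticePoint (1, 1)) (latticePoint (2, 1)) :=
      dist_pos.2 fun h => by simpa using latticePoint_injective h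
    positivity
  · rw [triangleCount, Nat.one_le_iff_ne_zero, ← Nat.pos_iff_ne_zero,
      Set.ncard_pos (trianglesOfPerimeter_finite _ _)]
    refine ⟨{latticePoint (1, 1), latticePoint (2, 1), latticePoint (1, 2)}, ?_, _, _, _, rfl,
      ?_, rfl⟩
    · rintro v hv
      simp only [Set.mem_insert_iff, Set.mem_singleton_iff] at hv
      rw [mem_grid_iff]
      rcases hv with rfl | rfl | rfl
      all_goals
        refine ⟨_, ?_, rfl⟩
        simp only [Finset.mem_product, Finset.mem_Icc]
        omega
    · rw [affineIndependent_latticePoint]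
      simp [twiceArea]

theorem exists_rpow_le_triangleCount : ∃ c : ℝ, 0 < c ∧ ∀ N : ℕ, 2 ≤ N → ∃ p : ℝ, 0 < p ∧
    c * (N : ℝ) ^ (5 / 2 : ℝ) ≤ triangleCount N p := by
  refine ⟨1 / 10 ^ 14, by positivity, fun N hN => ?_⟩
  have hN1 : (1 : ℝ) ≤ N := by exact_mod_cast (by omega : 1 ≤ N)
  have hsplit : (N : ℝ) ^ (5 / 2 : ℝ) = (N : ℝ) ^ 2 * √N := by
    rw [Real.sqrt_eq_rpow, ← Real.rpow_natCast, ← Real.rpow_add (by linarith)]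
    norm_num
  rw [hsplit]
  -- Below the threshold one triangle suffices, as `24000³ < 10¹⁴`. Above it, `R⁴ ≤ N/24000` keeps
  -- the construction's extent `12000R⁴` within half the grid, leaving `M = N/2` for the anchors.
  rcases lt_or_ge N 24000 with hsmall | hlarge
  · obtain ⟨p, hp, h1⟩ := exists_one_le_triangleCount hN
    refine ⟨p, hp, ?_⟩
    have h2 : (1 : ℝ) ≤ triangleCount N p := by exact_mod_cast h1
    have h3 : (N : ℝ) ≤ 24000 := by exact_mod_cast hsmall.le
    have h4 : √(N : ℝ) ≤ 24000 := by
      rw [Real.sqrt_le_left (by norm_num)]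
      nlinarith
    have h5 : (N : ℝ) ^ 2 * √N ≤ 24000 ^ 2 * 24000 := by gcongr
    linarith
  · set R := Nat.sqrt (Nat.sqrt (N / 24000)) with hR
    set K := N / 24000 with hK
    have hK1 : 1 ≤ K := by omega
    have hR0 : 0 < R := Nat.sqrt_pos.2 (Nat.sqrt_pos.2 hK1)
    have h1 : R ^ 4 ≤ K := by
      calc R ^ 4 = (R ^ 2) ^ 2 := by ring
        _ ≤ (Nat.sqrt K) ^ 2 := by gcongr; exact Nat.sqrt_le' _
        _ ≤ K := Nat.sqrt_le' _
    have h2 : K + 1 ≤ 16 * R ^ 4 := by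
      have a1 := Nat.succ_le_succ_sqrt' K
      have a2 := Nat.succ_le_succ_sqrt' (Nat.sqrt K)
      rw [← hR] at a2
      calc K + 1 ≤ (Nat.sqrt K + 1) ^ 2 := a1
        _ ≤ ((R + 1) ^ 2) ^ 2 := by gcongr
        _ ≤ ((2 * R) ^ 2) ^ 2 := by gcongr; omega
        _ = _ := by ring
    obtain ⟨p, hp, h3⟩ := exists_triangleCount_ge (M := N / 2) (N := N) hR0 (by omega)
    refine ⟨p, hp, le_trans ?_ h3⟩
    have h4 : (N : ℝ) ≤ 3 * ((N / 2 : ℕ) : ℝ) := by exact_mod_cast (by omega : N ≤ 3 * (N / 2))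
    have h5 : √(N : ℝ) ≤ 620 * (R : ℝ) ^ 2 := by
      rw [Real.sqrt_le_left (by positivity)]
      have : (N : ℝ) ≤ 384000 * (R : ℝ) ^ 4 := by
        exact_mod_cast (by omega : N ≤ 384000 * R ^ 4)
      nlinarith [(by positivity : (0 : ℝ) ≤ (R : ℝ) ^ 4)]
    have h6 : (N : ℝ) ^ 2 * √N ≤ (3 * ((N / 2 : ℕ) : ℝ)) ^ 2 * (620 * (R : ℝ) ^ 2) := by gcongr
    have h7 : 0 ≤ ((N / 2 : ℕ) : ℝ) ^ 2 * (R : ℝ) ^ 2 := by positivity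
    linarith

end GridTriangles

/-! ### Assembling the four bounds -/

theorem theorem2 :
    -- the maximum number of equal perimeter triangles in the `⌊√n⌋ × ⌊√n⌋` grid: upper bound
    (∃ C c : ℝ, 0 < C ∧ 0 < c ∧ ∀ n : ℕ, 3 ≤ n →
      (GridTriangles.maxTriangleCount ⌊Real.sqrt (n : ℝ)⌋₊ : ℝ) ≤
        C * (n : ℝ) ^ ((3 / 2 : ℝ) + c / Real.log (Real.log (n : ℝ)))) ∧
    -- and lower bound
    (∃ c : ℝ, 0 < c ∧ ∀ n : ℕ, 4 ≤ n →
      c * (n : ℝ) ^ (5 / 4 : ℝ) ≤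
        (GridTriangles.maxTriangleCount ⌊Real.sqrt (n : ℝ)⌋₊ : ℝ)) ∧
    -- the `n × n` grid: upper bound, uniform in the perimeter
    (∃ C c : ℝ, 0 < C ∧ 0 < c ∧ ∀ n : ℕ, 3 ≤ n → ∀ p : ℝ,
      (GridTriangles.triangleCount n p : ℝ) ≤
        C * (n : ℝ) ^ ((3 : ℝ) + c / Real.log (Real.log (n : ℝ)))) ∧
    -- and lower bound, for some perimeter
    (∃ c : ℝ, 0 < c ∧ ∀ n : ℕ, 2 ≤ n → ∃ p : ℝ, 0 < p ∧
      c * (n : ℝ) ^ (5 / 2 : ℝ) ≤ (GridTriangles.triangleCount n p : ℝ)) := by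
  obtain ⟨C, c, hC, hc, hup⟩ := GridTriangles.exists_triangleCount_le
  obtain ⟨c', hc', hlow⟩ := GridTriangles.exists_rpow_le_triangleCount
  refine ⟨⟨C, c, hC, hc, fun n hn => ?_⟩, ⟨c' / 8, by positivity, fun n hn => ?_⟩,
    ⟨C, c, hC, hc, fun n hn p => ?_⟩, c', hc', hlow⟩
  · have hn0 : (0 : ℝ) < n := by exact_mod_cast (by omega : 0 < n)
    obtain ⟨p, hp⟩ := (GridTriangles.isGreatest_maxTriangleCount ⌊Real.sqrt (n : ℝ)⌋₊).1
    rw [← hp, Real.rpow_add hn0, ← mul_assoc]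
    have hfl : (⌊Real.sqrt (n : ℝ)⌋₊ : ℝ) ≤ √(n : ℝ) := Nat.floor_le (Real.sqrt_nonneg _)
    have hle : ⌊Real.sqrt (n : ℝ)⌋₊ ≤ n := by
      rw [Real.nat_floor_real_sqrt_eq_nat_sqrt]; exact Nat.sqrt_le_self n
    refine (hup n hn _ hle p).trans ?_
    have h3 : (n : ℝ) ^ (3 / 2 : ℝ) = √(n : ℝ) ^ 3 := by
      rw [Real.sqrt_eq_rpow, ← Real.rpow_natCast, ← Real.rpow_mul hn0.le]
      norm_num
    rw [h3]
    gcongr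
  · set N := ⌊Real.sqrt (n : ℝ)⌋₊ with hN
    have hNs : N = Nat.sqrt n := Real.nat_floor_real_sqrt_eq_nat_sqrt
    have hN2 : 2 ≤ N := by rw [hNs, Nat.le_sqrt]; omega
    obtain ⟨p, -, hp⟩ := hlow N hN2
    have hmax : GridTriangles.triangleCount N p ≤ GridTriangles.maxTriangleCount N :=
      (GridTriangles.isGreatest_maxTriangleCount N).2 ⟨p, rfl⟩
    have hmax' : (GridTriangles.triangleCount N p : ℝ) ≤ GridTriangles.maxTriangleCount N := by
      exact_mod_cast hmax
    -- Rounding at most halves `√n`, so replacing `n^(5/4)` by `N^(5/2)` costs at most `2^(5/2) ≤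
    -- 8`.
    have hn4 : (n : ℝ) ≤ (2 * (N : ℝ)) ^ 2 := by
      have h1 : n < (N + 1) ^ 2 := by rw [hNs]; exact Nat.lt_succ_sqrt' n
      have h2 : (N + 1) ^ 2 ≤ (2 * N) ^ 2 := by gcongr; omega
      exact_mod_cast h1.le.trans h2
    have h4 : (n : ℝ) ^ (5 / 4 : ℝ) ≤ 8 * (N : ℝ) ^ (5 / 2 : ℝ) := by
      calc (n : ℝ) ^ (5 / 4 : ℝ) ≤ ((2 * (N : ℝ)) ^ 2) ^ (5 / 4 : ℝ) := by gcongr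
        _ = 2 ^ (5 / 2 : ℝ) * (N : ℝ) ^ (5 / 2 : ℝ) := by
          rw [← Real.rpow_natCast, ← Real.rpow_mul (by positivity),
            ← Real.mul_rpow (by norm_num) (by positivity)]
          norm_num
        _ ≤ 2 ^ (3 : ℝ) * (N : ℝ) ^ (5 / 2 : ℝ) := by
          gcongr <;> norm_num
        _ = _ := by norm_num
    calc c' / 8 * (n : ℝ) ^ (5 / 4 : ℝ) ≤ c' / 8 * (8 * (N : ℝ) ^ (5 / 2 : ℝ)) := by gcongr
      _ = c' * (N : ℝ) ^ (5 / 2 : ℝ) := by ring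
      _ ≤ _ := hp.trans hmax'
  · have hn0 : (0 : ℝ) < n := by exact_mod_cast (by omega : 0 < n)
    rw [Real.rpow_add hn0, ← mul_assoc]
    have h3 : (n : ℝ) ^ (3 : ℝ) = (n : ℝ) ^ 3 := by
      rw [← Real.rpow_natCast]; norm_num
    rw [h3]
    exact hup n hn n le_rfl p
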